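/- **Theorem.** Let $M$ be a connected (Hausdorff) $C^\infty$ manifold of finite dimension, $h$ a smooth Riemannian metric on $M$, and $W$ a smooth vector field on $M$ with $h(W,W)<1$ everywhere. Put $\lambda = 1-h(W,W)$ and let $$\mathcal F(x,y)=\frac{\sqrt{h_x(y,W)^2+\lambda\,h_x(y,y)}}{\lambda}-\frac{h_x(y,W)}{\lambda}\qquad (x\in M,\ y\in T_xM)$$ be the Randers metric associated with the navigation data $(h,W)$. Put $\beta=-\tfrac1\lambda h(W,\cdot)$ and $\alpha=\tfrac1\lambda h+\beta\otimes\beta$ (so that $\mathcal F(x,y)=\sqrt{\alpha_x(y,y)}+\beta_x(y)$), and let $\beta^\sharp$ be the vector field dual to $\beta$ with respect to $\alpha$, i.e. $\alpha(\beta^\sharp,\cdot)=\beta$. Call $\mathcal F$ *Wagnerian* (a generalized Berwald metric) if there is a smooth linear connection on $M$, possibly with torsion, whose parallel transports along smooth curves preserve $\mathcal F$. 1. $W$ has constant length with respect to $h$ if and only if $\mathcal F$ is Wagnerian. 2. $\beta^\sharp$ has constant length with respect to $\alpha$ if and only if $\mathcal F$ is Wagnerian. 3. The Levi-Civita connection $\nabla^\alpha$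 of $\alpha$ exists, and if $W$ has constant length with respect to $h$, then $$\nabla_XY=\nabla^\alpha_XY+\frac{\alpha(\nabla^\alpha_X\beta^\sharp,Y)\,\beta^\sharp-\alpha(Y,\beta^\sharp)\,\nabla^\alpha_X\beta^\sharp}{\alpha(\beta^\sharp,\beta^\sharp)}$$ (the fraction being read as $0$ when $W\equiv 0$) defines a smooth linear connection on $M$ which satisfies $\nabla\alpha=0$ and $\nabla\beta^\sharp=0$ and whose parallel transports along smooth curves preserve $\mathcal F$. -/

import Mathlib

open Bundle Set
open scoped Manifold ContDiff

noncomputable section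

namespace Zermelo

section Connections

variable {n : ℕ} {M : Type*} [TopologicalSpace M] [ChartedSpace (EuclideanSpace ℝ (Fin n)) M]

/-- A vector field `X` has constant length with respect to a family `g` of bilinear forms on the
tangent spaces. -/
def HasConstantLength
    (g : ∀ x : M, TangentSpace (𝓡 n) x →L[ℝ] TangentSpace (𝓡 n) x →L[ℝ] ℝ)
    (X : ∀ x : M, TangentSpace (𝓡 n) x) : Prop :=
  ∃ r : ℝ, ∀ x : M, Real.sqrt (g x (X x) (X x)) = r

variable [IsManifold (𝓡 n) ∞ M]

/-- The covariant derivative `DV/dt` at time `t` of a vector field `V` along a curve `c`, both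
considered on the time set `s`. If `v` is the expression of `V` in the local coordinate frame
`∂₁, …, ∂ₙ` around `c t`, this is `(dvᵏ/dt) ∂ₖ + vʲ ∇_{ċ} ∂ⱼ` at `c t`; the local field
`vʲ(t) ∂ⱼ`, with coefficients frozen at time `t`, is `fun x ↦ e.symm x (v t)`. -/
def covDerivAlong
    (cov : CovariantDerivative (𝓡 n) (EuclideanSpace ℝ (Fin n))
      (TangentSpace (𝓡 n) : M → Type _))
    (c : ℝ → M) (V : ∀ t, TangentSpace (𝓡 n) (c t)) (s : Set ℝ) (t : ℝ) :
    TangentSpace (𝓡 n) (c t) :=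
  let e := trivializationAt (EuclideanSpace ℝ (Fin n)) (TangentSpace (𝓡 n) : M → Type _) (c t)
  let v : ℝ → EuclideanSpace ℝ (Fin n) :=
    fun τ ↦ (e (TotalSpace.mk' (EuclideanSpace ℝ (Fin n)) (c τ) (V τ))).2
  e.symm (c t) (derivWithin v s t) +
    cov (fun x ↦ e.symm x (v t)) (c t) (mfderivWithin 𝓘(ℝ, ℝ) (𝓡 n) c s t (1 : ℝ))

/-- The vector field `V` along the curve `c` is parallel on the time set `s`. -/
def IsParallelAlong
    (cov : CovariantDerivative (𝓡 n) (EuclideanSpace ℝ (Fin n))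
      (TangentSpace (𝓡 n) : M → Type _))
    (c : ℝ → M) (V : ∀ t, TangentSpace (𝓡 n) (c t)) (s : Set ℝ) : Prop :=
  MDifferentiableOn 𝓘(ℝ, ℝ) (𝓡 n).tangent
    (fun t ↦ (TotalSpace.mk' (EuclideanSpace ℝ (Fin n)) (c t) (V t) : TangentBundle (𝓡 n) M)) s ∧
  ∀ t ∈ s, covDerivAlong cov c V s t = 0

/-- The parallel transports of the linear connection `cov` along smooth curves preserve the
function `F` on the tangent bundle. -/
def PreservesByTransport
    (cov : CovariantDerivative (𝓡 n) (EuclideanSpace ℝ (Fin n))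
      (TangentSpace (𝓡 n) : M → Type _))
    (F : ∀ x : M, TangentSpace (𝓡 n) x → ℝ) : Prop :=
  ∀ a b : ℝ, a < b → ∀ c : ℝ → M, ContMDiffOn 𝓘(ℝ, ℝ) (𝓡 n) ∞ c (Icc a b) →
    ∀ V : ∀ t, TangentSpace (𝓡 n) (c t), IsParallelAlong cov c V (Icc a b) →
      F (c a) (V a) = F (c b) (V b)

/-- `F` is Wagnerian, i.e. a generalized Berwald metric: there is a (smooth) linear connection on
the base manifold, possibly with torsion, whose parallel transports preserve `F`. -/
def IsWagnerian (F : ∀ x : M, TangentSpace (𝓡 n) x → ℝ) : Prop :=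
  ∃ cov : CovariantDerivative (𝓡 n) (EuclideanSpace ℝ (Fin n))
      (TangentSpace (𝓡 n) : M → Type _),
    CovariantDerivative.ContMDiffCovariantDerivative cov ∞ ∧ PreservesByTransport cov F

/-- `∇ g = 0`, i.e. `X (g (Y, Z)) = g (∇_X Y, Z) + g (Y, ∇_X Z)`. -/
def IsMetricFor
    (g : ∀ x : M, TangentSpace (𝓡 n) x →L[ℝ] TangentSpace (𝓡 n) x →L[ℝ] ℝ)
    (cov : CovariantDerivative (𝓡 n) (EuclideanSpace ℝ (Fin n))
      (TangentSpace (𝓡 n) : M → Type _)) : Prop :=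
  ∀ (Y Z : ∀ x : M, TangentSpace (𝓡 n) x) (x : M),
    MDifferentiableAt (𝓡 n) (𝓡 n).tangent
      (fun y ↦ (TotalSpace.mk' (EuclideanSpace ℝ (Fin n)) y (Y y) : TangentBundle (𝓡 n) M)) x →
    MDifferentiableAt (𝓡 n) (𝓡 n).tangent
      (fun y ↦ (TotalSpace.mk' (EuclideanSpace ℝ (Fin n)) y (Z y) : TangentBundle (𝓡 n) M)) x →
    ∀ v : TangentSpace (𝓡 n) x,
      mvfderiv (𝓡 n) (fun y ↦ g y (Y y) (Z y)) x v =
        g x (cov Y x v) (Z x) + g x (Y x) (cov Z x v)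

/-- `cov` is the Levi-Civita connection of `g`: smooth, torsion free and metric. -/
def IsLeviCivita
    (g : ∀ x : M, TangentSpace (𝓡 n) x →L[ℝ] TangentSpace (𝓡 n) x →L[ℝ] ℝ)
    (cov : CovariantDerivative (𝓡 n) (EuclideanSpace ℝ (Fin n))
      (TangentSpace (𝓡 n) : M → Type _)) : Prop :=
  CovariantDerivative.ContMDiffCovariantDerivative cov ∞ ∧ cov.torsion = 0 ∧ IsMetricFor g cov

end Connections

section Navigation

variable {n : ℕ} {M : Type*} [TopologicalSpace M] [ChartedSpace (EuclideanSpace ℝ (Fin n)) M]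
  [IsManifold (𝓡 n) ∞ M]
  (h : ContMDiffRiemannianMetric (𝓡 n) ∞ (EuclideanSpace ℝ (Fin n))
    (TangentSpace (𝓡 n) : M → Type _))
  (W : ∀ x : M, TangentSpace (𝓡 n) x)

/-- `λ = 1 - ‖W‖²`. -/
def lam (x : M) : ℝ := 1 - h.inner x (W x) (W x)

/-- The Randers metric of the navigation data `(h, W)`. -/
def randersNorm (x : M) (y : TangentSpace (𝓡 n) x) : ℝ :=
  Real.sqrt (h.inner x y (W x) ^ 2 + lam h W x * h.inner x y y) / lam h W x -
    h.inner x y (W x) / lam h W x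

/-- The one-form `β = -λ⁻¹ h(W, ·)`. -/
def beta (x : M) : TangentSpace (𝓡 n) x →L[ℝ] ℝ := -((lam h W x)⁻¹ • h.inner x (W x))

/-- The Riemannian metric `α = λ⁻¹ h + β ⊗ β`. -/
def alpha (x : M) : TangentSpace (𝓡 n) x →L[ℝ] TangentSpace (𝓡 n) x →L[ℝ] ℝ :=
  (lam h W x)⁻¹ • h.inner x + (beta h W x).smulRight (beta h W x)

/-- The vector field `β^♯` dual to `β` with respect to `α`, i.e. `α(β^♯, ·) = β`. -/
def betaSharp (x : M) : TangentSpace (𝓡 n) x := (alpha h W x).inverse (beta h W x)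

end Navigation

end Zermelo

end

/-! Everything rests on the splitting `F = √α + β` of the Randers metric `F` and on the identity
`α(β♯, β♯) = h(W, W)`, which follows from `β♯ = -λW`. The second identity makes the two
constant-length conditions equivalent, so only the link with Wagnerian metrics remains.

Suppose that a linear connection preserves `F`. If `V` is parallel, so is `-V`; half the sum and
half the difference of `F(V)` and `F(-V)` show that `√α(V, V)` and `β(V)` are both preserved.
Transport `β♯(p)` to a nearby point `q` and call the result `z`. Then `α(z, z)` and `β(z) = α(β♯(q),
z)` both equal `|β♯(p)|²`, so Cauchy-Schwarz at `q` gives `|β♯(p)| ≤ |β♯(q)|`. Exchanging `p` and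
`q` makes the length locally constant, hence constant as `M` is connected
(`inner_self_le_of_isParallelAlong`, `IsWagnerian.hasConstantLength`). Only local existence of
transport is needed: along short coordinate segments it is a linear differential equation with small
coefficients (`exists_isParallelAlong`).

Conversely, let the length be constant. The term added to `∇^α` is skew with respect to `α`, so the
new connection is still metric. Constant length means `∇^α_X β♯ ⟂ β♯`, so on `β♯` the added term is
`-∇^α_X β♯` and `β♯` becomes parallel. Along a parallel field `V` the functions `α(V, V)` and `β(V)
= α(β♯, V)` are then constant, and so is `F(V)`. The Levi-Civita connection itself is obtained from
the Koszul formula (`exists_isLeviCivita`). -/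

open scoped Topology

/-! ### Locality and Leibniz rules for covariant derivatives. -/

section CovariantDerivativeSums

variable {E : Type*} [NormedAddCommGroup E] [NormedSpace ℝ E]
  {H : Type*} [TopologicalSpace H] {I : ModelWithCorners ℝ E H}
  {M : Type*} [TopologicalSpace M] [ChartedSpace H M]
  {F : Type*} [NormedAddCommGroup F] [NormedSpace ℝ F]
  {V : M → Type*} [TopologicalSpace (TotalSpace F V)]
  [∀ x, AddCommGroup (V x)] [∀ x, Module ℝ (V x)] [∀ x : M, TopologicalSpace (V x)]
  [∀ x, IsTopologicalAddGroup (V x)] [∀ x, ContinuousSMul ℝ (V x)]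
  [FiberBundle F V]

/-- Two differentiable sections which agree near `x` have the same covariant derivative at `x`. -/
lemma CovariantDerivative.congr_of_eventuallyEq (cov : CovariantDerivative I F V)
    {σ σ' : Π x, V x} {x : M} (hσ : MDiffAt (T% σ) x) (h : ∀ᶠ y in 𝓝 x, σ y = σ' y) :
    cov σ x = cov σ' x := by
  refine cov.isCovariantDerivativeOnUniv.congr_of_eventuallyEq hσ ?_ Filter.univ_mem h
  refine hσ.congr_of_eventuallyEq (h.mono fun y hy ↦ ?_)
  simp [hy]

variable [VectorBundle ℝ F V]

/-- A covariant derivative is additive on finite sums of differentiable sections. -/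
lemma CovariantDerivative.sum (cov : CovariantDerivative I F V) {ι : Type*} (s : Finset ι)
    {σ : ι → Π x, V x} {x : M} (hσ : ∀ i ∈ s, MDiffAt (T% (σ i)) x) :
    cov (fun y ↦ ∑ i ∈ s, σ i y) x = ∑ i ∈ s, cov (σ i) x := by
  classical
  induction s using Finset.induction_on with
  | empty =>
    simp only [Finset.sum_empty]
    exact cov.isCovariantDerivativeOnUniv.zero
  | insert a s ha ih =>
    simp only [Finset.sum_insert ha]
    rw [← ih fun i hi ↦ hσ i (Finset.mem_insert_of_mem hi)]
    exact cov.isCovariantDerivativeOnUniv.add (hσ a (Finset.mem_insert_self a s))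
      (MDifferentiableAt.sum_section fun i hi ↦ hσ i (Finset.mem_insert_of_mem hi))

/-- The Leibniz rule for a linear combination of sections with variable coefficients. -/
lemma CovariantDerivative.sum_smul (cov : CovariantDerivative I F V) {ι : Type*} (s : Finset ι)
    {f : ι → M → ℝ} {σ : ι → Π x, V x} {x : M} (hf : ∀ i ∈ s, MDiffAt (f i) x)
    (hσ : ∀ i ∈ s, MDiffAt (T% (σ i)) x) (u : TangentSpace I x) :
    cov (fun y ↦ ∑ i ∈ s, f i y • σ i y) x u =
      ∑ i ∈ s, (mvfderiv I (f i) x u • σ i x + f i x • cov (σ i) x u) := by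
  have h := cov.sum s (σ := fun i ↦ f i • σ i) (x := x)
    fun i hi ↦ (hf i hi).smul_section (hσ i hi)
  refine (congrArg (fun A ↦ A u) h).trans ?_
  rw [sum_apply]
  refine Finset.sum_congr rfl fun i hi ↦ ?_
  rw [cov.isCovariantDerivativeOnUniv.leibniz (hσ i hi) (hf i hi)]
  simp [add_comm]

end CovariantDerivativeSums

/-! ### Smooth local frames, and functions along curves. -/

section Frames

variable {E : Type*} [NormedAddCommGroup E] [NormedSpace ℝ E]
  {H : Type*} [TopologicalSpace H] {I : ModelWithCorners ℝ E H}
  {M : Type*} [TopologicalSpace M] [ChartedSpace H M]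
  {F : Type*} [NormedAddCommGroup F] [NormedSpace ℝ F]
  {V : M → Type*} [TopologicalSpace (TotalSpace F V)]
  [∀ x, AddCommGroup (V x)] [∀ x, Module ℝ (V x)] [∀ x : M, TopologicalSpace (V x)]
  [FiberBundle F V] [VectorBundle ℝ F V]
  (e : Trivialization F (π F V)) [MemTrivializationAtlas e]

lemma Bundle.Trivialization.contMDiffAt_symmL_apply {k : ℕ∞ω} [ContMDiffVectorBundle k F V I] {x : M}
    (hx : x ∈ e.baseSet) (v : F) : CMDiffAt k (T% (fun y ↦ e.symmL ℝ y v)) x := by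
  rw [e.contMDiffAt_section_iff hx]
  refine (contMDiffAt_const (c := v)).congr_of_eventuallyEq ?_
  filter_upwards [e.open_baseSet.mem_nhds hx] with y hy
  rw [e.symmL_apply hy]
  simp [e.apply_mk_symm hy]

lemma Bundle.Trivialization.mdifferentiableAt_symmL_apply [ContMDiffVectorBundle 1 F V I] {x : M}
    (hx : x ∈ e.baseSet) (v : F) : MDiffAt (T% (fun y ↦ e.symmL ℝ y v)) x :=
  (e.contMDiffAt_symmL_apply hx v (k := 1)).mdifferentiableAt one_ne_zero

end Frames

section Curves

variable {E : Type*} [NormedAddCommGroup E] [NormedSpace ℝ E]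
  {H : Type*} [TopologicalSpace H] {I : ModelWithCorners ℝ E H}
  {M : Type*} [TopologicalSpace M] [ChartedSpace H M]

/-- The chain rule for a function along a curve. -/
lemma MDifferentiableAt.hasDerivWithinAt_comp_curve {f : M → ℝ} {c : ℝ → M} {s : Set ℝ} {t : ℝ}
    (hf : MDiffAt f (c t)) (hc : MDifferentiableWithinAt 𝓘(ℝ, ℝ) I c s t) :
    HasDerivWithinAt (fun τ ↦ f (c τ))
      (mvfderiv I f (c t) (mfderivWithin 𝓘(ℝ, ℝ) I c s t (1 : ℝ))) s t := by
  have h := hf.hasMFDerivAt.comp_hasMFDerivWithinAt t hc.hasMFDerivWithinAt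
  have h' : HasFDerivWithinAt (fun τ ↦ f (c τ)) ((mvfderiv I f (c t)).comp
    (mfderivWithin 𝓘(ℝ, ℝ) I c s t) : ℝ →L[ℝ] ℝ) s t := hasMFDerivWithinAt_iff_hasFDerivWithinAt.1 h
  exact h'.hasDerivWithinAt

end Curves

/-! ### The covariant derivative along a curve. -/

namespace Zermelo

section Connections

variable {n : ℕ} {M : Type*} [TopologicalSpace M] [ChartedSpace (EuclideanSpace ℝ (Fin n)) M]
  [IsManifold (𝓡 n) ∞ M]
  (cov : CovariantDerivative (𝓡 n) (EuclideanSpace ℝ (Fin n)) (TangentSpace (𝓡 n) : M → Type _))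

/-- The vector field `Y` is differentiable at `x`. -/
abbrev VDiffAt (Y : ∀ x : M, TangentSpace (𝓡 n) x) (x : M) : Prop :=
  MDifferentiableAt (𝓡 n) (𝓡 n).tangent
    (fun y ↦ (TotalSpace.mk' (EuclideanSpace ℝ (Fin n)) y (Y y) : TangentBundle (𝓡 n) M)) x

/-- The covariant derivative along a curve of a combination of vector fields with time-dependent
coefficients. -/
lemma covDerivAlong_eq_sum {ι : Type*} [Fintype ι] {c : ℝ → M}
    {V : ∀ t, TangentSpace (𝓡 n) (c t)} {s : Set ℝ} {t : ℝ} (ht : t ∈ s)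
    (hs : UniqueDiffWithinAt ℝ s t) (hc : MDifferentiableWithinAt 𝓘(ℝ, ℝ) (𝓡 n) c s t)
    {f : ι → ℝ → ℝ} {f' : ι → ℝ} (hf : ∀ i, HasDerivWithinAt (f i) (f' i) s t)
    {Y : ι → ∀ x : M, TangentSpace (𝓡 n) x} (hY : ∀ i, VDiffAt (Y i) (c t))
    (hV : ∀ᶠ τ in 𝓝[s] t, V τ = ∑ i, f i τ • Y i (c τ)) :
    covDerivAlong cov c V s t = ∑ i, (f' i • Y i (c t) +
      f i t • cov (Y i) (c t) (mfderivWithin 𝓘(ℝ, ℝ) (𝓡 n) c s t (1 : ℝ))) := by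
  set F := EuclideanSpace ℝ (Fin n)
  set e := trivializationAt F (TangentSpace (𝓡 n) : M → Type _) (c t) with he
  have hmem : c t ∈ e.baseSet := FiberBundle.mem_baseSet_trivializationAt F _ (c t)
  have hnear : ∀ᶠ y in 𝓝 (c t), y ∈ e.baseSet := e.open_baseSet.mem_nhds hmem
  have hnear' : ∀ᶠ τ in 𝓝[s] t, c τ ∈ e.baseSet := hc.continuousWithinAt hnear
  set b := Module.finBasis ℝ F
  let ℓ (j) : F →L[ℝ] ℝ := (b.coord j).toContinuousLinearMap
  have hb (v : F) : ∑ j, ℓ j v • b j = v := b.sum_repr v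
  set y : ι → M → F := fun i x ↦ (e ⟨x, Y i x⟩).2 with hy
  have hyd (i) : MDifferentiableAt (𝓡 n) 𝓘(ℝ, F) (y i) (c t) := (e.mdifferentiableAt_section_iff _ _ hmem).1 (hY i)
  have hyd' (i j) : MDifferentiableAt (𝓡 n) 𝓘(ℝ, ℝ) (fun x ↦ ℓ j (y i x)) (c t) :=
    (ℓ j).differentiableAt.comp_mdifferentiableAt (hyd i)
  set u := mfderivWithin 𝓘(ℝ, ℝ) (𝓡 n) c s t (1 : ℝ) with hu
  -- Both sides of the claim are expanded in the coordinate frame at `c t`. Locality allows each `Y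
  -- i` to be replaced by its frame expansion, valid only near `c t`.
  have hYy (i) : ∀ᶠ x in 𝓝 (c t), Y i x = ∑ j, ℓ j (y i x) • e.symmL ℝ x (b j) := by
    filter_upwards [hnear] with x hx
    simp only [← map_smul, ← map_sum, hb]
    rw [e.symmL_apply hx]
    exact (e.symm_apply_apply_mk hx (Y i x)).symm
  have hcovY (i) : cov (Y i) (c t) u = ∑ j, (mvfderiv (𝓡 n) (fun x ↦ ℓ j (y i x)) (c t) u •
      e.symmL ℝ (c t) (b j) + ℓ j (y i (c t)) • cov (fun x ↦ e.symmL ℝ x (b j)) (c t) u) := by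
    rw [cov.congr_of_eventuallyEq (hY i) (hYy i)]
    exact cov.sum_smul _ (fun j _ ↦ hyd' i j) (fun j _ ↦ e.mdifferentiableAt_symmL_apply hmem (b j)) u
  set v : ℝ → F := fun τ ↦ (e (TotalSpace.mk' F (c τ) (V τ))).2 with hv
  have hvy : ∀ᶠ τ in 𝓝[s] t, v τ = ∑ i, f i τ • y i (c τ) := by
    filter_upwards [hnear', hV] with τ h1 h2
    have h3 (w : TangentSpace (𝓡 n) (c τ)) :
        (e (TotalSpace.mk' F (c τ) w)).2 = e.continuousLinearMapAt ℝ (c τ) w := by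
      rw [e.continuousLinearMapAt_apply_of_mem (R := ℝ) h1]
    simp only [hv, hy, h2]
    rw [h3, map_sum]
    exact Finset.sum_congr rfl fun i _ ↦ by rw [map_smul, ← h3]
  have hvt : v t = ∑ i, f i t • y i (c t) := hvy.self_of_nhdsWithin ht
  have hyc (i j) := (hyd' i j).hasDerivWithinAt_comp_curve hc
  have hvd : HasDerivWithinAt v (∑ j, (∑ i, (f' i * ℓ j (y i (c t)) +
      f i t * mvfderiv (𝓡 n) (fun x ↦ ℓ j (y i x)) (c t) u)) • b j) s t := by
    have h1 : HasDerivWithinAt (fun τ ↦ ∑ j, (∑ i, f i τ * ℓ j (y i (c τ))) • b j)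
      (∑ j, (∑ i, (f' i * ℓ j (y i (c t)) +
      f i t * mvfderiv (𝓡 n) (fun x ↦ ℓ j (y i x)) (c t) u)) • b j) s t :=
      HasDerivWithinAt.fun_sum fun j _ ↦
        (HasDerivWithinAt.fun_sum fun i _ ↦ (hf i).mul (hyc i j)).smul_const (b j)
    have h2 : ∀ᶠ τ in 𝓝[s] t, v τ = ∑ j, (∑ i, f i τ * ℓ j (y i (c τ))) • b j := by
      filter_upwards [hvy] with τ h
      rw [← hb (v τ), h]
      simp
    exact h1.congr_of_eventuallyEq h2 (h2.self_of_nhdsWithin ht)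
  -- The coefficients are frozen at time `t`, so the Leibniz rule produces no derivative terms here;
  -- those come from `derivWithin v s t`.
  have hcovE : cov (fun x ↦ e.symm x (v t)) (c t) u =
      ∑ j, ℓ j (v t) • cov (fun x ↦ e.symmL ℝ x (b j)) (c t) u := by
    have h1 : ∀ᶠ x in 𝓝 (c t), e.symm x (v t) = ∑ j, ℓ j (v t) • e.symmL ℝ x (b j) := by
      filter_upwards [hnear] with x hx
      simp only [← map_smul, ← map_sum, hb]
      exact (e.symmL_apply hx _).symm
    rw [cov.congr_of_eventuallyEq (σ := fun x ↦ e.symm x (v t)) ?_ h1]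
    swap
    · refine (e.mdifferentiableAt_symmL_apply hmem (v t)).congr_of_eventuallyEq ?_
      filter_upwards [hnear] with x hx
      rw [e.symmL_apply hx]
    refine (cov.sum_smul Finset.univ (f := fun j _ ↦ ℓ j (v t)) (fun j _ ↦ mdifferentiableAt_const)
      (fun j _ ↦ e.mdifferentiableAt_symmL_apply hmem (b j)) u).trans ?_
    refine Finset.sum_congr rfl fun j _ ↦ ?_
    rw [mvfderiv_const]
    exact (congrArg (· + _) (zero_smul ℝ _)).trans (zero_add _)
  have key : covDerivAlong cov c V s t =
      e.symm (c t) (derivWithin v s t) + cov (fun x ↦ e.symm x (v t)) (c t) u := rfl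
  rw [key, hvd.derivWithin hs, ← e.symmL_apply (R := ℝ) hmem, hcovE, hvt]
  simp only [hcovY, map_sum, map_smul, Finset.sum_smul, Finset.smul_sum]
  rw [Finset.sum_comm, Finset.sum_comm (s := Finset.univ (α := Fin _)), ← Finset.sum_add_distrib]
  refine Finset.sum_congr rfl fun i _ ↦ ?_
  conv_rhs => rw [(hYy i).self_of_nhds]
  rw [Finset.smul_sum, ← Finset.sum_add_distrib, ← Finset.sum_add_distrib]
  refine Finset.sum_congr rfl fun j _ ↦ ?_
  simp only [smul_eq_mul]
  module

end Connections

end Zermelo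

/-! ### Parallel bilinear forms and parallel fields along curves. -/

namespace Zermelo

section Transport

variable {n : ℕ} {M : Type*} [TopologicalSpace M] [ChartedSpace (EuclideanSpace ℝ (Fin n)) M]
  [IsManifold (𝓡 n) ∞ M]

/-- A differentiable vector field along a curve is a combination of a local frame with
differentiable coefficients. -/
lemma exists_coeff_along {ι : Type*} [Fintype ι]
    (b : Module.Basis ι ℝ (EuclideanSpace ℝ (Fin n)))
    {c : ℝ → M} {V : ∀ t, TangentSpace (𝓡 n) (c t)} {s : Set ℝ} {t : ℝ}
    (hV : MDifferentiableWithinAt 𝓘(ℝ, ℝ) (𝓡 n).tangent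
      (fun t ↦ (TotalSpace.mk' (EuclideanSpace ℝ (Fin n)) (c t) (V t) : TangentBundle (𝓡 n) M)) s t)
    (e : Trivialization (EuclideanSpace ℝ (Fin n))
      (π (EuclideanSpace ℝ (Fin n)) (TangentSpace (𝓡 n) : M → Type _))) [MemTrivializationAtlas e]
    (he : c t ∈ e.baseSet) :
    ∃ (f : ι → ℝ → ℝ) (f' : ι → ℝ), (∀ i, HasDerivWithinAt (f i) (f' i) s t) ∧
      ∀ᶠ τ in 𝓝[s] t, V τ = ∑ i, f i τ • e.symmL ℝ (c τ) (b i) := by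
  obtain ⟨hc, hv⟩ := (e.mdifferentiableWithinAt_totalSpace_iff _ _ (e.mem_source.2 he)).1 hV
  have hnear : ∀ᶠ τ in 𝓝[s] t, c τ ∈ e.baseSet :=
    hc.continuousWithinAt (e.open_baseSet.mem_nhds he)
  refine ⟨fun i τ ↦ (b.coord i).toContinuousLinearMap (e ⟨c τ, V τ⟩).2, _,
    fun i ↦ DifferentiableWithinAt.hasDerivWithinAt ?_, ?_⟩
  · exact ((b.coord i).toContinuousLinearMap.differentiableAt.comp_differentiableWithinAt t
      (mdifferentiableWithinAt_iff_differentiableWithinAt.1 hv))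
  · filter_upwards [hnear] with τ hτ
    simp only [← map_smul, ← map_sum]
    have hb (v : EuclideanSpace ℝ (Fin n)) :
      ∑ i, (b.coord i).toContinuousLinearMap v • b i = v := b.sum_repr v
    rw [hb, e.symmL_apply hτ]
    exact (e.symm_apply_apply_mk hτ (V τ)).symm

/-- The product rule for a parallel bilinear form evaluated on vector fields along a curve. -/
lemma IsMetricFor.hasDerivWithinAt_along
    {g : ∀ x : M, TangentSpace (𝓡 n) x →L[ℝ] TangentSpace (𝓡 n) x →L[ℝ] ℝ}
    {cov : CovariantDerivative (𝓡 n) (EuclideanSpace ℝ (Fin n))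
      (TangentSpace (𝓡 n) : M → Type _)} (hcov : IsMetricFor g cov)
    (hg : ∀ (Y Z : ∀ x : M, TangentSpace (𝓡 n) x) (x : M), VDiffAt Y x → VDiffAt Z x →
      MDifferentiableAt (𝓡 n) 𝓘(ℝ, ℝ) (fun y ↦ g y (Y y) (Z y)) x)
    {c : ℝ → M} {V U : ∀ t, TangentSpace (𝓡 n) (c t)} {s : Set ℝ} {t : ℝ}
    (ht : t ∈ s) (hs : UniqueDiffWithinAt ℝ s t)
    (hV : MDifferentiableWithinAt 𝓘(ℝ, ℝ) (𝓡 n).tangent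
      (fun t ↦ (TotalSpace.mk' (EuclideanSpace ℝ (Fin n)) (c t) (V t) : TangentBundle (𝓡 n) M)) s t)
    (hU : MDifferentiableWithinAt 𝓘(ℝ, ℝ) (𝓡 n).tangent
      (fun t ↦ (TotalSpace.mk' (EuclideanSpace ℝ (Fin n)) (c t) (U t) : TangentBundle (𝓡 n) M)) s t) :
    HasDerivWithinAt (fun τ ↦ g (c τ) (V τ) (U τ))
      (g (c t) (covDerivAlong cov c V s t) (U t) + g (c t) (V t) (covDerivAlong cov c U s t)) s t := by
  have hc := ((mdifferentiableWithinAt_totalSpace _ _).1 hV).1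
  set e := trivializationAt (EuclideanSpace ℝ (Fin n)) (TangentSpace (𝓡 n) : M → Type _) (c t)
  have hmem : c t ∈ e.baseSet := FiberBundle.mem_baseSet_trivializationAt _ _ (c t)
  set b := Module.finBasis ℝ (EuclideanSpace ℝ (Fin n))
  obtain ⟨f, f', hf, hVf⟩ := exists_coeff_along b hV e hmem
  obtain ⟨k, k', hk, hUk⟩ := exists_coeff_along b hU e hmem
  have hE (i) : VDiffAt (fun x ↦ e.symmL ℝ x (b i)) (c t) :=
    e.mdifferentiableAt_symmL_apply hmem (b i)
  rw [covDerivAlong_eq_sum cov ht hs hc hf hE hVf, covDerivAlong_eq_sum cov ht hs hc hk hE hUk]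
  -- In the frame the pairing is a sum of triple products of two coefficients and a Gram entry; the
  -- metric property differentiates the Gram entries.
  have hd := HasDerivWithinAt.fun_sum (u := Finset.univ) fun j _ ↦
    HasDerivWithinAt.fun_sum (u := Finset.univ) fun i _ ↦
      ((hf i).mul (hk j)).mul ((hg _ _ _ (hE i) (hE j)).hasDerivWithinAt_comp_curve hc)
  have heq : ∀ᶠ τ in 𝓝[s] t, g (c τ) (V τ) (U τ) = ∑ j, ∑ i, f i τ * k j τ *
      g (c τ) (e.symmL ℝ (c τ) (b i)) (e.symmL ℝ (c τ) (b j)) := by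
    filter_upwards [hVf, hUk] with τ h1 h2
    simp only [h1, h2, map_sum, map_smul, sum_apply, smul_apply, smul_eq_mul,
      Finset.mul_sum]
    exact Finset.sum_congr rfl fun j _ ↦ Finset.sum_congr rfl fun i _ ↦ by ring
  refine (hd.congr_of_eventuallyEq heq (heq.self_of_nhdsWithin ht)).congr_deriv ?_
  rw [hVf.self_of_nhdsWithin ht, hUk.self_of_nhdsWithin ht]
  simp only [map_sum, map_smul, map_add, sum_apply, smul_apply, add_apply, smul_eq_mul,
    Finset.mul_sum, ← Finset.sum_add_distrib]
  refine Finset.sum_congr rfl fun j _ ↦ Finset.sum_congr rfl fun i _ ↦ ?_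
  rw [hcov _ _ _ (hE i) (hE j), Pi.mul_apply]
  ring

/-- Parallel vector fields along a curve have constant product for a parallel bilinear form. -/
lemma IsMetricFor.eq_of_isParallelAlong
    {g : ∀ x : M, TangentSpace (𝓡 n) x →L[ℝ] TangentSpace (𝓡 n) x →L[ℝ] ℝ}
    {cov : CovariantDerivative (𝓡 n) (EuclideanSpace ℝ (Fin n))
      (TangentSpace (𝓡 n) : M → Type _)} (hcov : IsMetricFor g cov)
    (hg : ∀ (Y Z : ∀ x : M, TangentSpace (𝓡 n) x) (x : M), VDiffAt Y x → VDiffAt Z x →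
      MDifferentiableAt (𝓡 n) 𝓘(ℝ, ℝ) (fun y ↦ g y (Y y) (Z y)) x)
    {c : ℝ → M} {V U : ∀ t, TangentSpace (𝓡 n) (c t)} {a b : ℝ} (hab : a < b)
    (hV : IsParallelAlong cov c V (Icc a b)) (hU : IsParallelAlong cov c U (Icc a b)) :
    g (c a) (V a) (U a) = g (c b) (V b) (U b) := by
  have hd (t) (ht : t ∈ Icc a b) :
      HasDerivWithinAt (fun τ ↦ g (c τ) (V τ) (U τ)) 0 (Icc a b) t := by
    refine (hcov.hasDerivWithinAt_along hg ht (uniqueDiffOn_Icc hab t ht)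
      (hV.1 t ht) (hU.1 t ht)).congr_deriv ?_
    rw [hV.2 t ht, hU.2 t ht]
    simp
  refine (constant_of_derivWithin_zero (fun t ht ↦ (hd t ht).differentiableWithinAt)
    (fun t ht ↦ ?_) b (right_mem_Icc.2 hab.le)).symm
  have ht' := Ico_subset_Icc_self ht
  exact (hd t ht').derivWithin (uniqueDiffOn_Icc hab t ht')

/-- A parallel vector field is parallel along every curve. -/
lemma isParallelAlong_comp_curve
    {cov : CovariantDerivative (𝓡 n) (EuclideanSpace ℝ (Fin n))
      (TangentSpace (𝓡 n) : M → Type _)} {Y : ∀ x : M, TangentSpace (𝓡 n) x}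
    (hY : ∀ x, VDiffAt Y x) (h0 : ∀ x, cov Y x = 0) {c : ℝ → M} {s : Set ℝ}
    (hs : UniqueDiffOn ℝ s) (hc : MDifferentiableOn 𝓘(ℝ, ℝ) (𝓡 n) c s) :
    IsParallelAlong cov c (fun t ↦ Y (c t)) s := by
  refine ⟨fun t ht ↦ (hY (c t)).comp_mdifferentiableWithinAt t (hc t ht), fun t ht ↦ ?_⟩
  rw [covDerivAlong_eq_sum cov (ι := Unit) ht (hs t ht) (hc t ht) (f := fun _ _ ↦ 1)
    (f' := fun _ ↦ 0) (fun _ ↦ hasDerivWithinAt_const ..) (Y := fun _ ↦ Y) (fun _ ↦ hY _)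
    (Filter.Eventually.of_forall fun τ ↦ by simp)]
  simp [h0]

end Transport

end Zermelo

/-- A positive definite continuous bilinear form on a finite-dimensional space is invertible. -/
lemma ContinuousLinearMap.isInvertible_of_pos {E : Type*} [NormedAddCommGroup E] [NormedSpace ℝ E]
    [FiniteDimensional ℝ E] (g : E →L[ℝ] E →L[ℝ] ℝ) (hg : ∀ v, v ≠ 0 → 0 < g v v) :
    g.IsInvertible := by
  have hinj : Function.Injective (g : E →ₗ[ℝ] E →L[ℝ] ℝ) := by
    rw [injective_iff_map_eq_zero]
    intro v hv
    by_contra hne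
    have h1 := hg v hne
    have h2 : g v = 0 := hv
    simp [h2] at h1
  have hrank : Module.finrank ℝ E = Module.finrank ℝ (E →L[ℝ] ℝ) := by
    rw [← (LinearMap.toContinuousLinearMap (𝕜 := ℝ) (E := E) (F' := ℝ)).finrank_eq]
    exact Subspace.dual_finrank_eq.symm
  exact ⟨(LinearEquiv.ofInjectiveOfFinrankEq _ hinj hrank).toContinuousLinearEquiv, by ext; rfl⟩

/-! ### Pointwise algebra and regularity of the navigation data. -/

namespace Zermelo

section NavigationAlgebra

variable {n : ℕ} {M : Type*} [TopologicalSpace M] [ChartedSpace (EuclideanSpace ℝ (Fin n)) M]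
  [IsManifold (𝓡 n) ∞ M]
  {h : ContMDiffRiemannianMetric (𝓡 n) ∞ (EuclideanSpace ℝ (Fin n))
    (TangentSpace (𝓡 n) : M → Type _)}
  {W : ∀ x : M, TangentSpace (𝓡 n) x}

lemma beta_apply (x : M) (y : TangentSpace (𝓡 n) x) :
    beta h W x y = -((lam h W x)⁻¹ * h.inner x (W x) y) := rfl

lemma alpha_apply (x : M) (y z : TangentSpace (𝓡 n) x) :
    alpha h W x y z = (lam h W x)⁻¹ * h.inner x y z + beta h W x y * beta h W x z := rfl

lemma alpha_symm (x : M) (y z : TangentSpace (𝓡 n) x) : alpha h W x y z = alpha h W x z y := by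
  rw [alpha_apply, alpha_apply, h.symm x y z, mul_comm (beta h W x y)]

lemma inner_self_nonneg (x : M) (y : TangentSpace (𝓡 n) x) : 0 ≤ h.inner x y y := by
  rcases eq_or_ne y 0 with rfl | hy
  · simp
  · exact (h.pos x y hy).le

lemma alpha_pos {x : M} (hx : 0 < lam h W x) (y : TangentSpace (𝓡 n) x) (hy : y ≠ 0) :
    0 < alpha h W x y y := by
  rw [alpha_apply]
  have := h.pos x y hy
  have := mul_self_nonneg (beta h W x y)
  positivity

lemma alpha_self_nonneg {x : M} (hx : 0 < lam h W x) (y : TangentSpace (𝓡 n) x) :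
    0 ≤ alpha h W x y y := by
  rcases eq_or_ne y 0 with rfl | hy
  · simp
  · exact (alpha_pos hx y hy).le

lemma alpha_isInvertible {x : M} (hx : 0 < lam h W x) : (alpha h W x).IsInvertible :=
  ContinuousLinearMap.isInvertible_of_pos (E := EuclideanSpace ℝ (Fin n)) (alpha h W x)
    (alpha_pos hx)

/-- Expanding `α(y, y)` gives the radicand of the Randers metric divided by `λ²`, and `λ > 0` allows
`λ` to leave the square root. This is what separates the even and odd parts of the metric. -/
lemma randersNorm_eq {x : M} (hx : 0 < lam h W x) (y : TangentSpace (𝓡 n) x) :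
    randersNorm h W x y = Real.sqrt (alpha h W x y y) + beta h W x y := by
  have h1 : alpha h W x y y =
      (h.inner x y (W x) ^ 2 + lam h W x * h.inner x y y) / lam h W x ^ 2 := by
    rw [alpha_apply, beta_apply, h.symm x (W x) y]
    field_simp
    ring
  rw [h1, Real.sqrt_div' _ (by positivity), Real.sqrt_sq hx.le, randersNorm, beta_apply,
    h.symm x (W x) y, div_eq_inv_mul (h.inner x y (W x)), sub_eq_add_neg]

/-- Since `β(-λW) = h(W, W) = 1 - λ`, the two parts of `α(-λW, ·)` are `-h(W, ·)` and `(1 - λ)β`,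
where `-h(W, ·) = λβ`. -/
lemma alpha_neg_lam_smul {x : M} (hx : 0 < lam h W x) :
    alpha h W x (-lam h W x • W x) = beta h W x := by
  ext y
  have h2 : h.inner x (W x) (W x) = 1 - lam h W x := by rw [lam]; ring
  rw [alpha_apply, beta_apply, beta_apply, map_smul, map_smul, smul_apply, h2, smul_eq_mul,
    smul_eq_mul]
  field_simp
  ring

lemma betaSharp_eq {x : M} (hx : 0 < lam h W x) : betaSharp h W x = -lam h W x • W x := by
  obtain ⟨A, hA⟩ := alpha_isInvertible hx
  rw [betaSharp, ← alpha_neg_lam_smul hx, ← hA, ContinuousLinearMap.inverse_equiv]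
  exact A.symm_apply_apply _

lemma alpha_betaSharp {x : M} (hx : 0 < lam h W x) :
    alpha h W x (betaSharp h W x) = beta h W x := by
  rw [betaSharp_eq hx, alpha_neg_lam_smul hx]

/-- The left side is `β(β♯) = β(-λW)`, where `λ` cancels. This identity makes the two
constant-length conditions the same. -/
lemma alpha_betaSharp_betaSharp {x : M} (hx : 0 < lam h W x) :
    alpha h W x (betaSharp h W x) (betaSharp h W x) = h.inner x (W x) (W x) := by
  rw [alpha_betaSharp hx, betaSharp_eq hx, beta_apply, map_smul, smul_eq_mul]
  field_simp

lemma lam_pos (hlt : ∀ x : M, h.inner x (W x) (W x) < 1) (x : M) : 0 < lam h W x :=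
  sub_pos.2 (hlt x)

lemma hasConstantLength_betaSharp_iff (hlt : ∀ x : M, h.inner x (W x) (W x) < 1) :
    HasConstantLength (alpha h W) (betaSharp h W) ↔ HasConstantLength h.inner W := by
  simp only [HasConstantLength, alpha_betaSharp_betaSharp (lam_pos hlt _)]

/-- The Cauchy-Schwarz inequality for `alpha`. -/
lemma alpha_cauchy_schwarz {x : M} (hx : 0 < lam h W x) (y z : TangentSpace (𝓡 n) x) :
    alpha h W x y z ^ 2 ≤ alpha h W x y y * alpha h W x z z := by
  rcases eq_or_ne z 0 with rfl | hz
  · simp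
  -- The vector `α(z, z) y - α(y, z) z` is `α(z, z)` times the part of `y` orthogonal to `z`; its
  -- square is `α(z, z)` times the Cauchy-Schwarz defect.
  have h1 := alpha_self_nonneg hx (alpha h W x z z • y - alpha h W x y z • z)
  have h2 := alpha_pos hx z hz
  simp only [map_sub, map_smul, sub_apply, smul_apply, smul_eq_mul, alpha_symm x z y] at h1
  have h3 : 0 ≤ alpha h W x z z * (alpha h W x y y * alpha h W x z z - alpha h W x y z ^ 2) := by
    linarith
  linarith [nonneg_of_mul_nonneg_right h3 h2]

/-- The vector field `Y` is smooth at `x`. -/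
abbrev VSmoothAt (Y : ∀ x : M, TangentSpace (𝓡 n) x) (x : M) : Prop :=
  ContMDiffAt (𝓡 n) (𝓡 n).tangent ∞
    (fun y ↦ (TotalSpace.mk' (EuclideanSpace ℝ (Fin n)) y (Y y) : TangentBundle (𝓡 n) M)) x

lemma VSmoothAt.vdiffAt {Y : ∀ x : M, TangentSpace (𝓡 n) x} {x : M} (hY : VSmoothAt Y x) :
    VDiffAt Y x :=
  ContMDiffAt.mdifferentiableAt hY (by simp)

lemma contMDiffAt_inner {Y Z : ∀ x : M, TangentSpace (𝓡 n) x} {x : M} (hY : VSmoothAt Y x)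
    (hZ : VSmoothAt Z x) :
    ContMDiffAt (𝓡 n) 𝓘(ℝ, ℝ) ∞ (fun y ↦ h.inner y (Y y) (Z y)) x := by
  have : ContMDiffAt (𝓡 n) ((𝓡 n).prod 𝓘(ℝ, ℝ)) ∞
      (fun m ↦ TotalSpace.mk' ℝ (E := Bundle.Trivial M ℝ) m (h.inner m (Y m) (Z m))) x :=
    ContMDiffAt.clm_bundle_apply₂ (F₁ := EuclideanSpace ℝ (Fin n))
      (F₂ := EuclideanSpace ℝ (Fin n)) h.contMDiff.contMDiffAt hY hZ
  exact (contMDiffAt_totalSpace.1 this).2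

lemma mdifferentiableAt_inner {Y Z : ∀ x : M, TangentSpace (𝓡 n) x} {x : M} (hY : VDiffAt Y x)
    (hZ : VDiffAt Z x) :
    MDifferentiableAt (𝓡 n) 𝓘(ℝ, ℝ) (fun y ↦ h.inner y (Y y) (Z y)) x := by
  have : MDifferentiableAt (𝓡 n) ((𝓡 n).prod 𝓘(ℝ, ℝ))
      (fun m ↦ TotalSpace.mk' ℝ (E := Bundle.Trivial M ℝ) m (h.inner m (Y m) (Z m))) x :=
    MDifferentiableAt.clm_bundle_apply₂ (F₁ := EuclideanSpace ℝ (Fin n))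
      (F₂ := EuclideanSpace ℝ (Fin n)) (h.contMDiff.mdifferentiableAt (by simp)) hY hZ
  exact ((mdifferentiableAt_totalSpace _ _).1 this).2

lemma contMDiffAt_lam {x : M} (hW : VSmoothAt W x) :
    ContMDiffAt (𝓡 n) 𝓘(ℝ, ℝ) ∞ (lam h W) x :=
  contMDiffAt_const.sub (contMDiffAt_inner hW hW)

lemma contMDiffAt_alpha {Y Z : ∀ x : M, TangentSpace (𝓡 n) x} {x : M} (hx : 0 < lam h W x)
    (hW : VSmoothAt W x) (hY : VSmoothAt Y x) (hZ : VSmoothAt Z x) :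
    ContMDiffAt (𝓡 n) 𝓘(ℝ, ℝ) ∞ (fun y ↦ alpha h W y (Y y) (Z y)) x := by
  have hl : ContMDiffAt (𝓡 n) 𝓘(ℝ, ℝ) ∞ (fun y ↦ (lam h W y)⁻¹) x :=
    (contMDiffAt_lam hW).inv₀ hx.ne'
  exact (hl.mul (contMDiffAt_inner hY hZ)).add
    ((hl.mul (contMDiffAt_inner hW hY)).neg.mul (hl.mul (contMDiffAt_inner hW hZ)).neg)

lemma mdifferentiableAt_alpha {Y Z : ∀ x : M, TangentSpace (𝓡 n) x} {x : M} (hx : 0 < lam h W x)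
    (hW : VSmoothAt W x) (hY : VDiffAt Y x) (hZ : VDiffAt Z x) :
    MDifferentiableAt (𝓡 n) 𝓘(ℝ, ℝ) (fun y ↦ alpha h W y (Y y) (Z y)) x := by
  have hl : MDifferentiableAt (𝓡 n) 𝓘(ℝ, ℝ) (fun y ↦ (lam h W y)⁻¹) x :=
    ((contMDiffAt_lam hW).inv₀ hx.ne').mdifferentiableAt (by simp)
  exact (hl.mul (mdifferentiableAt_inner hY hZ)).add
    ((hl.mul (mdifferentiableAt_inner hW.vdiffAt hY)).neg.mul
      (hl.mul (mdifferentiableAt_inner hW.vdiffAt hZ)).neg)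

lemma vsmoothAt_betaSharp (hlt : ∀ x : M, h.inner x (W x) (W x) < 1) {x : M}
    (hW : VSmoothAt W x) : VSmoothAt (betaSharp h W) x := by
  have h1 : betaSharp h W = fun y ↦ -lam h W y • W y :=
    funext fun y ↦ betaSharp_eq (lam_pos hlt y)
  rw [h1]
  exact (contMDiffAt_lam hW).neg.smul_section hW

end NavigationAlgebra

end Zermelo

/-! ### Local existence of parallel transport. -/

/-- Existence of solutions of a linear differential equation on the unit interval when the
coefficients are at most `1 / 2`. -/
lemma exists_linear_ode_solution {F : Type*} [NormedAddCommGroup F] [NormedSpace ℝ F]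
    [CompleteSpace F] {A : ℝ → F →L[ℝ] F} (hA : ContinuousOn A (Icc 0 1))
    (hle : ∀ t ∈ Icc (0 : ℝ) 1, ‖A t‖ ≤ 1 / 2) (v₀ : F) :
    ∃ f : ℝ → F, f 0 = v₀ ∧ ∀ t ∈ Icc (0 : ℝ) 1, HasDerivWithinAt f (A t (f t)) (Icc 0 1) t := by
  -- On the ball of radius `‖v₀‖` about `v₀` vectors have norm at most `2‖v₀‖`, so the field is
  -- bounded by `‖v₀‖`, and a solution cannot leave the ball within unit time. Any Lipschitz
  -- constant above `1 / 2` would do in place of `1`.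
  have hpl : IsPicardLindelof (fun t v ↦ A t v) (tmin := 0) (tmax := 1) ⟨0, by simp⟩ v₀
      ‖v₀‖₊ 0 ‖v₀‖₊ 1 :=
    { lipschitzOnWith := fun t ht ↦ by
        refine ((A t).lipschitz.weaken ?_).lipschitzOnWith
        rw [← NNReal.coe_le_coe]
        have := hle t ht
        simp only [coe_nnnorm, NNReal.coe_one]
        linarith
      continuousOn := fun v _ ↦ hA.clm_apply continuousOn_const
      norm_le := fun t ht v hv ↦ by
        have h1 : ‖v - v₀‖ ≤ ‖v₀‖ := by simpa [dist_eq_norm] using hv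
        have h2 : ‖v‖ ≤ ‖v₀‖ + ‖v₀‖ := by
          calc ‖v‖ = ‖(v - v₀) + v₀‖ := by simp
            _ ≤ _ := (norm_add_le _ _).trans (by gcongr)
        calc ‖A t v‖ ≤ ‖A t‖ * ‖v‖ := (A t).le_opNorm v
          _ ≤ 1 / 2 * (‖v₀‖ + ‖v₀‖) := by gcongr; exact hle t ht
          _ = ‖v₀‖ := by ring
      mul_max_le := by simp }
  obtain ⟨f, h0, hf⟩ := hpl.exists_eq_forall_mem_Icc_hasDerivWithinAt₀
  exact ⟨f, h0, hf⟩

lemma continuousOn_sum_smulRight_smulRight {X ι κ F F' G : Type*} [TopologicalSpace X]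
    [Fintype ι] [Fintype κ] [NormedAddCommGroup F] [NormedSpace ℝ F] [NormedAddCommGroup F']
    [NormedSpace ℝ F'] [NormedAddCommGroup G] [NormedSpace ℝ G] (k : κ → F →L[ℝ] ℝ)
    (l : ι → F' →L[ℝ] ℝ) {g : ι → κ → X → G} {s : Set X} (hg : ∀ i j, ContinuousOn (g i j) s) :
    ContinuousOn (fun x ↦ ∑ i, ∑ j, (k j).smulRight ((l i).smulRight (g i j x))) s :=
  continuousOn_finsetSum _ fun i _ ↦ continuousOn_finsetSum _ fun j _ ↦
    ((ContinuousLinearMap.smulRightL ℝ F (F' →L[ℝ] G) (k j)).continuous.comp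
      (ContinuousLinearMap.smulRightL ℝ F' G (l i)).continuous).comp_continuousOn (hg i j)

namespace Zermelo

section WagnerianConstantLength

variable {n : ℕ} {M : Type*} [TopologicalSpace M] [ChartedSpace (EuclideanSpace ℝ (Fin n)) M]
  [IsManifold (𝓡 n) ∞ M]
  {cov : CovariantDerivative (𝓡 n) (EuclideanSpace ℝ (Fin n)) (TangentSpace (𝓡 n) : M → Type _)}

/-- A smooth covariant derivative sends vector fields which are smooth near a point to sections
which are smooth near this point. -/
lemma contMDiffAt_cov [T2Space M] (hcov : CovariantDerivative.ContMDiffCovariantDerivative cov ∞)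
    {Y : ∀ x : M, TangentSpace (𝓡 n) x} {x₀ : M}
    {u : Set M} (hu : u ∈ 𝓝 x₀) (hY : ∀ x ∈ u, VSmoothAt Y x) :
    ContMDiffAt (𝓡 n) ((𝓡 n).prod
      𝓘(ℝ, EuclideanSpace ℝ (Fin n) →L[ℝ] EuclideanSpace ℝ (Fin n))) ∞
      (fun x ↦ TotalSpace.mk' (EuclideanSpace ℝ (Fin n) →L[ℝ] EuclideanSpace ℝ (Fin n))
        (E := fun x : M ↦ TangentSpace (𝓡 n) x →L[ℝ] TangentSpace (𝓡 n) x) x (cov Y x)) x₀ := by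
  obtain ⟨v, hvu, hv, hxv⟩ := mem_nhds_iff.1 hu
  -- Smoothness of the connection is stated for globally smooth fields, so `Y` is cut off by a bump
  -- function equal to `1` near `x₀`; locality then removes the cutoff.
  obtain ⟨ψ, -, hψ⟩ := (SmoothBumpFunction.nhds_basis_tsupport (I := 𝓡 n) x₀).mem_iff.1
    (hv.mem_nhds hxv)
  have hYv : ContMDiffOn (𝓡 n) (𝓡 n).tangent ∞ (fun y ↦
      (TotalSpace.mk' (EuclideanSpace ℝ (Fin n)) y (Y y) : TangentBundle (𝓡 n) M)) v :=
    fun x hx ↦ (hY x (hvu hx)).contMDiffWithinAt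
  have hs := ContMDiffOn.smul_section_of_tsupport (ψ.contMDiff.contMDiffOn) hv hψ hYv
  have h1 := hcov.contMDiff.contMDiff (σ := (ψ : M → ℝ) • Y) (by simpa using hs.contMDiffOn)
  refine (h1.contMDiffAt Filter.univ_mem).congr_of_eventuallyEq ?_
  filter_upwards [ψ.eventuallyEq_one.eventually_nhds, hv.mem_nhds hxv] with x hx hxv'
  have : cov Y x = cov ((ψ : M → ℝ) • Y) x := by
    refine cov.congr_of_eventuallyEq (hY x (hvu hxv')).vdiffAt ?_
    filter_upwards [hx] with y hy
    simp [hy]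
  rw [this]

/-- The connection coefficients of a smooth covariant derivative in a local trivialization. -/
lemma exists_connection_coefficients [T2Space M]
    (hcov : CovariantDerivative.ContMDiffCovariantDerivative cov ∞)
    (e : Trivialization (EuclideanSpace ℝ (Fin n))
      (π (EuclideanSpace ℝ (Fin n)) (TangentSpace (𝓡 n) : M → Type _))) [MemTrivializationAtlas e] :
    ∃ B : M → EuclideanSpace ℝ (Fin n) →L[ℝ] EuclideanSpace ℝ (Fin n) →L[ℝ]
      EuclideanSpace ℝ (Fin n), ContinuousOn B e.baseSet ∧ ∀ x ∈ e.baseSet, ∀ v w,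
      cov (fun y ↦ e.symmL ℝ y w) x (e.symmL ℝ x v) = e.symmL ℝ x (B x v w) := by
  set F := EuclideanSpace ℝ (Fin n)
  set b := Module.finBasis ℝ F
  let ℓ (j) : F →L[ℝ] ℝ := (b.coord j).toContinuousLinearMap
  have hb (v : F) : ∑ j, ℓ j v • b j = v := b.sum_repr v
  -- These are the Christoffel symbols: the coordinates of the derivative of the frame field `i` in
  -- the direction of the frame field `j`.
  set G : Fin _ → Fin _ → M → F := fun i j x ↦
    (e ⟨x, cov (fun y ↦ e.symmL ℝ y (b i)) x (e.symmL ℝ x (b j))⟩).2 with hG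
  have hGs (i j) (x) (hx : x ∈ e.baseSet) : ContMDiffAt (𝓡 n) 𝓘(ℝ, F) ∞ (G i j) x := by
    rw [hG, ← e.contMDiffAt_section_iff hx]
    exact ContMDiffAt.clm_bundle_apply (F₁ := F) (F₂ := F)
      (contMDiffAt_cov hcov (e.open_baseSet.mem_nhds hx)
        fun y hy ↦ e.contMDiffAt_symmL_apply hy (b i)) (e.contMDiffAt_symmL_apply hx (b j))
  refine ⟨fun x ↦ ∑ i, ∑ j, (ℓ j).smulRight ((ℓ i).smulRight (G i j x)), ?_, fun x hx v w ↦ ?_⟩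
  · exact continuousOn_sum_smulRight_smulRight ℓ ℓ
      fun i j x hx ↦ (hGs i j x hx).continuousAt.continuousWithinAt
  · have hGij (i j) : e.symmL ℝ x (G i j x) =
        cov (fun y ↦ e.symmL ℝ y (b i)) x (e.symmL ℝ x (b j)) := by
      rw [e.symmL_apply hx]
      exact e.symm_apply_apply_mk hx _
    have hw : cov (fun y ↦ e.symmL ℝ y w) x (e.symmL ℝ x v) =
        ∑ i, ℓ i w • cov (fun y ↦ e.symmL ℝ y (b i)) x (e.symmL ℝ x v) := by
      have h1 : (fun y ↦ e.symmL ℝ y w) = fun y ↦ ∑ i, ℓ i w • e.symmL ℝ y (b i) := by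
        ext1 y
        simp only [← map_smul, ← map_sum, hb]
      rw [h1]
      refine (cov.sum_smul Finset.univ (f := fun j _ ↦ ℓ j w)
        (fun j _ ↦ mdifferentiableAt_const)
        (fun j _ ↦ e.mdifferentiableAt_symmL_apply hx (b j)) _).trans ?_
      refine Finset.sum_congr rfl fun j _ ↦ ?_
      rw [mvfderiv_const]
      exact (congrArg (· + _) (zero_smul ℝ _)).trans (zero_add _)
    rw [hw]
    conv_lhs => rw [← hb v]
    simp only [map_sum, map_smul, sum_apply, ContinuousLinearMap.smulRight_apply, smul_apply, hGij,
      Finset.smul_sum]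
    exact Finset.sum_congr rfl fun i _ ↦ Finset.sum_congr rfl fun j _ ↦ smul_comm _ _ _

end WagnerianConstantLength

end Zermelo

/-- Used to bound the Christoffel symbols near a point, which fixes how short the segments must be.
-/
lemma ContinuousOn.eventually_norm_lt_norm_add_one {X E F G : Type*} [TopologicalSpace X]
    [NormedAddCommGroup E] [NormedSpace ℝ E] [NormedAddCommGroup F] [NormedSpace ℝ F]
    [NormedAddCommGroup G] [NormedSpace ℝ G] {f : X → E →L[ℝ] F →L[ℝ] G} {s : Set X} {x : X}
    (hf : ContinuousOn f s) (hs : s ∈ 𝓝 x) :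
    ∀ᶠ z in 𝓝 x, ‖f z‖ < ‖f x‖ + 1 := by
  have h1 := hf.continuousAt hs
  have h2 : ContinuousAt (fun z ↦ ‖f z‖) x :=
    (continuous_norm (E := E →L[ℝ] F →L[ℝ] G)).continuousAt.comp h1
  exact h2.eventually_lt_const (lt_add_one _)

/-! ### Transport along coordinate segments; Wagnerian metrics force constant length. -/

namespace Zermelo

section WagnerianConstantLength

variable {n : ℕ} {M : Type*} [TopologicalSpace M] [ChartedSpace (EuclideanSpace ℝ (Fin n)) M]
  [IsManifold (𝓡 n) ∞ M]
  {cov : CovariantDerivative (𝓡 n) (EuclideanSpace ℝ (Fin n)) (TangentSpace (𝓡 n) : M → Type _)}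

/-- Solutions of the parallel transport equation in a local trivialization are parallel. -/
lemma isParallelAlong_of_hasDerivWithinAt
    (e : Trivialization (EuclideanSpace ℝ (Fin n))
      (π (EuclideanSpace ℝ (Fin n)) (TangentSpace (𝓡 n) : M → Type _))) [MemTrivializationAtlas e]
    {B : M → EuclideanSpace ℝ (Fin n) →L[ℝ] EuclideanSpace ℝ (Fin n) →L[ℝ]
      EuclideanSpace ℝ (Fin n)}
    (hB : ∀ x ∈ e.baseSet, ∀ v w,
      cov (fun y ↦ e.symmL ℝ y w) x (e.symmL ℝ x v) = e.symmL ℝ x (B x v w))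
    {c : ℝ → M} {s : Set ℝ} (hs : UniqueDiffOn ℝ s) (hce : ∀ t ∈ s, c t ∈ e.baseSet)
    (hc : MDifferentiableOn 𝓘(ℝ, ℝ) (𝓡 n) c s) {v : EuclideanSpace ℝ (Fin n)}
    (hcv : ∀ t ∈ s, mfderivWithin 𝓘(ℝ, ℝ) (𝓡 n) c s t (1 : ℝ) = e.symmL ℝ (c t) v)
    {f : ℝ → EuclideanSpace ℝ (Fin n)}
    (hf : ∀ t ∈ s, HasDerivWithinAt f (-B (c t) v (f t)) s t) :
    IsParallelAlong cov c (fun t ↦ e.symmL ℝ (c t) (f t)) s := by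
  set b := Module.finBasis ℝ (EuclideanSpace ℝ (Fin n))
  let ℓ (j) : EuclideanSpace ℝ (Fin n) →L[ℝ] ℝ := (b.coord j).toContinuousLinearMap
  have hb (v : EuclideanSpace ℝ (Fin n)) : ∑ j, ℓ j v • b j = v := b.sum_repr v
  refine ⟨fun t ht ↦ ?_, fun t ht ↦ ?_⟩
  · refine (e.mdifferentiableWithinAt_totalSpace_iff _ _ (e.mem_source.2 (hce t ht))).2
      ⟨hc t ht, ?_⟩
    have h1 : MDifferentiableWithinAt 𝓘(ℝ, ℝ) 𝓘(ℝ, EuclideanSpace ℝ (Fin n)) f s t :=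
      (hf t ht).differentiableWithinAt.mdifferentiableWithinAt
    refine h1.congr_of_eventuallyEq ?_ ?_
    · filter_upwards [self_mem_nhdsWithin] with τ hτ
      rw [e.symmL_apply (hce τ hτ), e.apply_mk_symm (hce τ hτ)]
    · change (e ⟨c t, e.symmL ℝ (c t) (f t)⟩).2 = f t
      rw [e.symmL_apply (hce t ht), e.apply_mk_symm (hce t ht)]
  · rw [covDerivAlong_eq_sum cov ht (hs t ht) (hc t ht) (f := fun j τ ↦ ℓ j (f τ))
      (f' := fun j ↦ ℓ j (-B (c t) v (f t)))
      (fun j ↦ ((ℓ j).hasFDerivAt.comp_hasDerivWithinAt t (hf t ht)))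
      (Y := fun j x ↦ e.symmL ℝ x (b j))
      (fun j ↦ e.mdifferentiableAt_symmL_apply (hce t ht) (b j))
      (Filter.Eventually.of_forall fun τ ↦ by simp only [← map_smul, ← map_sum, hb]), hcv t ht]
    -- The equation contributes `-B v f` through the derivative of the coefficients, and the
    -- derivative of the frame contributes `B v f`.
    simp only [hB _ (hce t ht), Finset.sum_add_distrib]
    simp only [← map_smul, ← map_sum, hb]
    rw [← map_add, neg_add_cancel, map_zero]

/-- Coordinate lines are smooth curves with constant velocity in the coordinate frame. -/
lemma coordinate_line (x₀ : M) {z v : EuclideanSpace ℝ (Fin n)} {s : Set ℝ}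
    (hs : UniqueDiffOn ℝ s) (hz : ∀ t ∈ s, z + t • v ∈ (extChartAt (𝓡 n) x₀).target) :
    ContMDiffOn 𝓘(ℝ, ℝ) (𝓡 n) ∞ (fun t : ℝ ↦ (extChartAt (𝓡 n) x₀).symm (z + t • v)) s ∧
    ∀ t ∈ s, mfderivWithin 𝓘(ℝ, ℝ) (𝓡 n)
      (fun t : ℝ ↦ (extChartAt (𝓡 n) x₀).symm (z + t • v)) s t (1 : ℝ) =
      (trivializationAt (EuclideanSpace ℝ (Fin n)) (TangentSpace (𝓡 n)) x₀).symmL ℝ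
        ((extChartAt (𝓡 n) x₀).symm (z + t • v)) v := by
  have hl : ContMDiff 𝓘(ℝ, ℝ) 𝓘(ℝ, EuclideanSpace ℝ (Fin n)) ∞ (fun t : ℝ ↦ z + t • v) := by
    rw [contMDiff_iff_contDiff]
    fun_prop
  refine ⟨(contMDiffOn_extChartAt_symm x₀).comp hl.contMDiffOn hz, fun t ht ↦ ?_⟩
  have hmem := hz t ht
  have hsrc : (extChartAt (𝓡 n) x₀).symm (z + t • v) ∈ (chartAt (EuclideanSpace ℝ (Fin n)) x₀).source := by
    rw [← extChartAt_source (𝓡 n)]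
    exact (extChartAt (𝓡 n) x₀).map_target hmem
  have hd : HasMFDerivWithinAt 𝓘(ℝ, ℝ) 𝓘(ℝ, EuclideanSpace ℝ (Fin n)) (fun t : ℝ ↦ z + t • v) s t
      (ContinuousLinearMap.toSpanSingleton ℝ v) := by
    have h1 : HasDerivAt (fun t : ℝ ↦ z + t • v) ((1 : ℝ) • v) t :=
      ((hasDerivAt_id t).smul_const v).const_add z
    rw [one_smul] at h1
    exact h1.hasDerivWithinAt.hasFDerivWithinAt.hasMFDerivWithinAt
  have hφ : MDifferentiableWithinAt 𝓘(ℝ, EuclideanSpace ℝ (Fin n)) (𝓡 n)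
      (extChartAt (𝓡 n) x₀).symm (range (𝓡 n)) (z + t • v) :=
    mdifferentiableWithinAt_extChartAt_symm hmem
  rw [TangentBundle.symmL_trivializationAt hsrc, (extChartAt (𝓡 n) x₀).right_inv hmem]
  have hcomp := hφ.hasMFDerivWithinAt.comp t hd (fun τ _ ↦ by simp)
  have h2 := hcomp.mfderivWithin (uniqueMDiffWithinAt_iff_uniqueDiffWithinAt.2 (hs t ht))
  have h3 := congrArg (fun A : ℝ →L[ℝ] EuclideanSpace ℝ (Fin n) ↦ A 1) h2
  refine h3.trans ?_
  change (mfderivWithin 𝓘(ℝ, EuclideanSpace ℝ (Fin n)) (𝓡 n) (extChartAt (𝓡 n) x₀).symm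
    (range (𝓡 n)) (z + t • v)) ((1 : ℝ) • v) = _
  rw [one_smul]
  rfl

/-- Every vector can be transported parallelly between sufficiently close points. -/
lemma exists_isParallelAlong [T2Space M]
    (hcov : CovariantDerivative.ContMDiffCovariantDerivative cov ∞) (x₀ : M) :
    ∃ U ∈ 𝓝 x₀, ∀ p ∈ U, ∀ q ∈ U, ∀ y : TangentSpace (𝓡 n) p,
      ∃ (c : ℝ → M) (V : ∀ t, TangentSpace (𝓡 n) (c t)),
        ContMDiffOn 𝓘(ℝ, ℝ) (𝓡 n) ∞ c (Icc 0 1) ∧ IsParallelAlong cov c V (Icc 0 1) ∧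
        IsParallelAlong cov c (fun t ↦ -V t) (Icc 0 1) ∧
        (TotalSpace.mk' (EuclideanSpace ℝ (Fin n)) (c 0) (V 0) : TangentBundle (𝓡 n) M) =
          TotalSpace.mk' (EuclideanSpace ℝ (Fin n)) p y ∧ c 1 = q := by
  set φ := extChartAt (𝓡 n) x₀ with hφ
  set e := trivializationAt (EuclideanSpace ℝ (Fin n)) (TangentSpace (𝓡 n) : M → Type _) x₀ with he
  have hsrc : e.baseSet = φ.source := by
    rw [hφ, extChartAt_source, he, TangentBundle.trivializationAt_baseSet]
  obtain ⟨B, hBc, hB⟩ := exists_connection_coefficients hcov e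
  have hBφ : ContinuousOn (fun z ↦ B (φ.symm z)) φ.target :=
    hBc.comp (continuousOn_extChartAt_symm x₀) fun z hz ↦ hsrc ▸ φ.map_target hz
  have hx₀ : φ x₀ ∈ φ.target := φ.map_source (mem_extChartAt_source x₀)
  have hopen : IsOpen φ.target := isOpen_extChartAt_target x₀
  set C := ‖B (φ.symm (φ x₀))‖ + 1 with hC
  have hC0 : 0 < C := by positivity
  have hnear : ∀ᶠ z in 𝓝 (φ x₀), z ∈ φ.target ∧ ‖B (φ.symm z)‖ < C := by
    refine (hopen.eventually_mem hx₀).and ?_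
    exact hBφ.eventually_norm_lt_norm_add_one (hopen.mem_nhds hx₀)
  obtain ⟨r, hr, hball⟩ := Metric.eventually_nhds_iff_ball.1 hnear
  -- Two points of the coordinate ball of radius `ρ` differ by at most `2ρ ≤ 1 / (2C)`. As `‖B‖ < C`
  -- on the ball of radius `r`, the transport equation has coefficients of norm at most `1 / 2`
  -- along the segment.
  set ρ := min r (1 / (4 * C)) with hρ
  have hρ0 : 0 < ρ := by positivity
  refine ⟨φ.source ∩ φ ⁻¹' Metric.ball (φ x₀) ρ, ?_, ?_⟩
  · exact Filter.inter_mem (extChartAt_source_mem_nhds x₀)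
      ((continuousAt_extChartAt x₀).preimage_mem_nhds (Metric.ball_mem_nhds _ hρ0))
  rintro p ⟨hp, hpρ⟩ q ⟨hq, hqρ⟩ y
  set v := φ q - φ p with hv
  have hvle : ‖v‖ ≤ 1 / (2 * C) := by
    have h1 : ‖v‖ ≤ ‖φ q - φ x₀‖ + ‖φ x₀ - φ p‖ := norm_sub_le_norm_sub_add_norm_sub ..
    have h2 : ‖φ q - φ x₀‖ < ρ := by simpa [dist_eq_norm] using hqρ
    have h3 : ‖φ x₀ - φ p‖ < ρ := by simpa [dist_eq_norm, norm_sub_rev] using hpρ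
    have h4 : ρ ≤ 1 / (4 * C) := min_le_right _ _
    have h5 : 1 / (2 * C) = 1 / (4 * C) + 1 / (4 * C) := by field_simp; norm_num
    linarith
  have hline (t) (ht : t ∈ Icc (0 : ℝ) 1) : φ p + t • v ∈ Metric.ball (φ x₀) r :=
    Metric.ball_subset_ball (min_le_left _ _)
      ((convex_ball (φ x₀) ρ).add_smul_sub_mem hpρ hqρ ht)
  have hu : UniqueDiffOn ℝ (Icc (0 : ℝ) 1) := uniqueDiffOn_Icc zero_lt_one
  obtain ⟨hc, hcv⟩ := coordinate_line x₀ hu fun t ht ↦ (hball _ (hline t ht)).1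
  set c : ℝ → M := fun t ↦ φ.symm (φ p + t • v) with hcdef
  have hce (t) (ht : t ∈ Icc (0 : ℝ) 1) : c t ∈ e.baseSet :=
    hsrc ▸ φ.map_target (hball _ (hline t ht)).1
  have hA : ContinuousOn (fun t ↦ -B (c t) v) (Icc 0 1) :=
    ((hBc.comp hc.continuousOn hce).clm_apply continuousOn_const).neg
  have hAle (t) (ht : t ∈ Icc (0 : ℝ) 1) : ‖-B (c t) v‖ ≤ 1 / 2 := by
    rw [norm_neg]
    calc ‖B (c t) v‖ ≤ ‖B (c t)‖ * ‖v‖ := (B (c t)).le_opNorm v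
      _ ≤ C * (1 / (2 * C)) := by
        gcongr
        exact (hball _ (hline t ht)).2.le
      _ = 1 / 2 := by field_simp
  obtain ⟨f, hf0, hf⟩ := exists_linear_ode_solution hA hAle (e ⟨p, y⟩).2
  have hc0 : c 0 = p := by simp [hcdef, hp]
  have hc1 : c 1 = q := by simp [hcdef, hv, hq]
  have hcd := hc.mdifferentiableOn (by simp)
  refine ⟨c, fun t ↦ e.symmL ℝ (c t) (f t), hc,
    isParallelAlong_of_hasDerivWithinAt e hB hu hce hcd hcv hf, ?_, ?_, hc1⟩
  · have h1 : IsParallelAlong cov c (fun t ↦ e.symmL ℝ (c t) (-f t)) (Icc 0 1) :=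
      isParallelAlong_of_hasDerivWithinAt e hB hu hce hcd hcv fun t ht ↦
        (hf t ht).neg.congr_deriv (by rw [map_neg, neg_apply])
    simpa only [map_neg] using h1
  · have hpe : p ∈ e.baseSet := hsrc ▸ hp
    change TotalSpace.mk' _ (c 0) (e.symmL ℝ (c 0) (f 0)) = _
    rw [hf0, hc0, e.symmL_apply hpe, e.symm_apply_apply_mk hpe]

/-- Parallel transports preserving the Randers metric do not decrease the length of `W`. -/
lemma inner_self_le_of_isParallelAlong {h : ContMDiffRiemannianMetric (𝓡 n) ∞
      (EuclideanSpace ℝ (Fin n)) (TangentSpace (𝓡 n) : M → Type _)}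
    {W : ∀ x : M, TangentSpace (𝓡 n) x} {p q : M} (hp : 0 < lam h W p) (hq : 0 < lam h W q)
    {z : TangentSpace (𝓡 n) q}
    (h1 : randersNorm h W p (betaSharp h W p) = randersNorm h W q z)
    (h2 : randersNorm h W p (-betaSharp h W p) = randersNorm h W q (-z)) :
    h.inner p (W p) (W p) ≤ h.inner q (W q) (W q) := by
  rw [randersNorm_eq hp, randersNorm_eq hq] at h1 h2
  simp only [map_neg, neg_apply, neg_neg] at h2
  -- Difference of `h1` and `h2`; the next step uses their sum.
  have hb : beta h W p (betaSharp h W p) = beta h W q z := by linarith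
  have hs : alpha h W p (betaSharp h W p) (betaSharp h W p) = alpha h W q z z :=
    (Real.sqrt_inj (alpha_self_nonneg hp _) (alpha_self_nonneg hq _)).1 (by linarith)
  have hcs := alpha_cauchy_schwarz hq (betaSharp h W q) z
  rw [alpha_betaSharp_betaSharp hq, ← hs, alpha_betaSharp hq, ← hb, ← alpha_betaSharp hp,
    alpha_betaSharp_betaSharp hp] at hcs
  -- `hcs` now reads `|W(p)|⁴ ≤ |W(q)|² |W(p)|²`; cancelling a factor requires `W(p) ≠ 0`.
  rcases (inner_self_nonneg (h := h) p (W p)).eq_or_lt with h0 | h0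
  · rw [← h0]
    exact inner_self_nonneg q (W q)
  · exact le_of_mul_le_mul_right (by rwa [sq] at hcs) h0

/-- If the Randers metric is Wagnerian, then the wind has constant length. -/
theorem IsWagnerian.hasConstantLength [T2Space M] [ConnectedSpace M]
    {h : ContMDiffRiemannianMetric (𝓡 n) ∞
      (EuclideanSpace ℝ (Fin n)) (TangentSpace (𝓡 n) : M → Type _)}
    {W : ∀ x : M, TangentSpace (𝓡 n) x} (hlt : ∀ x : M, h.inner x (W x) (W x) < 1)
    (hF : IsWagnerian (randersNorm h W)) : HasConstantLength h.inner W := by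
  obtain ⟨cov, hcov, hpres⟩ := hF
  have hloc : IsLocallyConstant (fun x : M ↦ h.inner x (W x) (W x)) := by
    rw [IsLocallyConstant.iff_eventually_eq]
    intro x₀
    obtain ⟨U, hU, hpar⟩ := exists_isParallelAlong hcov x₀
    have hle (p) (hp : p ∈ U) (q) (hq : q ∈ U) :
        h.inner p (W p) (W p) ≤ h.inner q (W q) (W q) := by
      obtain ⟨c, V, hc, hV, hV', heq, rfl⟩ := hpar p hp q hq (betaSharp h W p)
      have h1 := hpres 0 1 zero_lt_one c hc V hV
      have h2 := hpres 0 1 zero_lt_one c hc _ hV'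
      -- The points `c 0` and `p` are only propositionally equal, so their tangent vectors are
      -- compared in the total space.
      have key {x y : M} {v : TangentSpace (𝓡 n) x} {w : TangentSpace (𝓡 n) y}
          (hvw : (TotalSpace.mk' (EuclideanSpace ℝ (Fin n)) x v : TangentBundle (𝓡 n) M) =
            TotalSpace.mk' (EuclideanSpace ℝ (Fin n)) y w) :
          randersNorm h W x v = randersNorm h W y w ∧
            randersNorm h W x (-v) = randersNorm h W y (-w) := by
        cases hvw
        exact ⟨rfl, rfl⟩
      obtain ⟨e1, e2⟩ := key heq
      exact inner_self_le_of_isParallelAlong (lam_pos hlt p) (lam_pos hlt _)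
        (e1.symm.trans h1) (e2.symm.trans h2)
    filter_upwards [hU] with p hp
    exact le_antisymm (hle p hp x₀ (mem_of_mem_nhds hU)) (hle x₀ (mem_of_mem_nhds hU) p hp)
  obtain ⟨x₀⟩ : Nonempty M := inferInstance
  refine ⟨Real.sqrt (h.inner x₀ (W x₀) (W x₀)), fun x ↦ ?_⟩
  have h1 : h.inner x (W x) (W x) = h.inner x₀ (W x₀) (W x₀) :=
    hloc.apply_eq_of_isPreconnected isPreconnected_univ (mem_univ x) (mem_univ x₀)
  rw [h1]

end WagnerianConstantLength

end Zermelo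

/-! ### The Koszul expression and its behaviour in each argument. -/

namespace Zermelo

section Koszul

open VectorField

variable {n : ℕ} {M : Type*} [TopologicalSpace M] [ChartedSpace (EuclideanSpace ℝ (Fin n)) M]
  {g : ∀ x : M, TangentSpace (𝓡 n) x →L[ℝ] TangentSpace (𝓡 n) x →L[ℝ] ℝ}
  {X X' Y Y' Z Z' : ∀ x : M, TangentSpace (𝓡 n) x} {x : M}

/-- The Koszul expression, which is `2 g(∇_X Y, Z)` for the Levi-Civita connection `∇` of `g`. -/
noncomputable def koszul (g : ∀ x : M, TangentSpace (𝓡 n) x →L[ℝ] TangentSpace (𝓡 n) x →L[ℝ] ℝ)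
    (X Y Z : ∀ x : M, TangentSpace (𝓡 n) x) (x : M) : ℝ :=
  mvfderiv (𝓡 n) (fun y ↦ g y (Y y) (Z y)) x (X x) +
    mvfderiv (𝓡 n) (fun y ↦ g y (X y) (Z y)) x (Y x) -
    mvfderiv (𝓡 n) (fun y ↦ g y (X y) (Y y)) x (Z x) +
    g x (mlieBracket (𝓡 n) X Y x) (Z x) - g x (mlieBracket (𝓡 n) X Z x) (Y x) -
    g x (mlieBracket (𝓡 n) Y Z x) (X x)

/-- The terms symmetric in `X` and `Y` cancel. This yields vanishing torsion. -/
lemma koszul_sub_swap (hsymm : ∀ x v w, g x v w = g x w v) :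
    koszul g X Y Z x - koszul g Y X Z x = 2 * g x (mlieBracket (𝓡 n) X Y x) (Z x) := by
  have h1 : (fun y ↦ g y (Y y) (X y)) = fun y ↦ g y (X y) (Y y) := funext fun y ↦ hsymm _ _ _
  rw [koszul, koszul, h1, mlieBracket_swap_apply (V := Y) (W := X)]
  simp only [map_neg, neg_apply]
  ring

/-- Everything antisymmetric in `Y` and `Z` cancels. This yields compatibility with `g`. -/
lemma koszul_add_swap (hsymm : ∀ x v w, g x v w = g x w v) :
    koszul g X Y Z x + koszul g X Z Y x =
      2 * mvfderiv (𝓡 n) (fun y ↦ g y (Y y) (Z y)) x (X x) := by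
  have h1 : (fun y ↦ g y (Z y) (Y y)) = fun y ↦ g y (Y y) (Z y) := funext fun y ↦ hsymm _ _ _
  rw [koszul, koszul, h1, mlieBracket_swap_apply (V := Z) (W := Y)]
  simp only [map_neg, neg_apply]
  ring

variable [IsManifold (𝓡 n) ∞ M]

/-- The bilinear form `g` pairs differentiable vector fields to differentiable functions. -/
abbrev PairsDifferentiably
    (g : ∀ x : M, TangentSpace (𝓡 n) x →L[ℝ] TangentSpace (𝓡 n) x →L[ℝ] ℝ) : Prop :=
  ∀ Y Z x, VDiffAt Y x → VDiffAt Z x →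
    MDifferentiableAt (𝓡 n) 𝓘(ℝ, ℝ) (fun y ↦ g y (Y y) (Z y)) x

lemma mvfderiv_pairing_add_left (hg : PairsDifferentiably g) (hY : VDiffAt Y x)
    (hY' : VDiffAt Y' x) (hZ : VDiffAt Z x) :
    mvfderiv (𝓡 n) (fun y ↦ g y ((Y + Y') y) (Z y)) x =
      mvfderiv (𝓡 n) (fun y ↦ g y (Y y) (Z y)) x +
        mvfderiv (𝓡 n) (fun y ↦ g y (Y' y) (Z y)) x := by
  rw [← mvfderiv_add (hg Y Z x hY hZ) (hg Y' Z x hY' hZ)]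
  congr 1
  ext y
  simp

lemma mvfderiv_pairing_add_right (hg : PairsDifferentiably g) (hY : VDiffAt Y x)
    (hZ : VDiffAt Z x) (hZ' : VDiffAt Z' x) :
    mvfderiv (𝓡 n) (fun y ↦ g y (Y y) ((Z + Z') y)) x =
      mvfderiv (𝓡 n) (fun y ↦ g y (Y y) (Z y)) x +
        mvfderiv (𝓡 n) (fun y ↦ g y (Y y) (Z' y)) x := by
  rw [← mvfderiv_add (hg Y Z x hY hZ) (hg Y Z' x hY hZ')]
  congr 1
  ext y
  simp

lemma mvfderiv_pairing_smul_left (hg : PairsDifferentiably g) {f : M → ℝ}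
    (hf : MDifferentiableAt (𝓡 n) 𝓘(ℝ, ℝ) f x) (hY : VDiffAt Y x) (hZ : VDiffAt Z x)
    (v : TangentSpace (𝓡 n) x) :
    mvfderiv (𝓡 n) (fun y ↦ g y ((f • Y) y) (Z y)) x v =
      f x * mvfderiv (𝓡 n) (fun y ↦ g y (Y y) (Z y)) x v +
        mvfderiv (𝓡 n) f x v * g x (Y x) (Z x) := by
  have h1 : (fun y ↦ g y ((f • Y) y) (Z y)) = f * fun y ↦ g y (Y y) (Z y) := by
    ext y
    simp
  rw [h1, mvfderiv_mul hf (hg Y Z x hY hZ)]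
  simp [mul_comm]

lemma mvfderiv_pairing_smul_right (hg : PairsDifferentiably g) {f : M → ℝ}
    (hf : MDifferentiableAt (𝓡 n) 𝓘(ℝ, ℝ) f x) (hY : VDiffAt Y x) (hZ : VDiffAt Z x)
    (v : TangentSpace (𝓡 n) x) :
    mvfderiv (𝓡 n) (fun y ↦ g y (Y y) ((f • Z) y)) x v =
      f x * mvfderiv (𝓡 n) (fun y ↦ g y (Y y) (Z y)) x v +
        mvfderiv (𝓡 n) f x v * g x (Y x) (Z x) := by
  have h1 : (fun y ↦ g y (Y y) ((f • Z) y)) = f * fun y ↦ g y (Y y) (Z y) := by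
    ext y
    simp
  rw [h1, mvfderiv_mul hf (hg Y Z x hY hZ)]
  simp [mul_comm]

lemma koszul_add_left (hg : PairsDifferentiably g) (hX : VDiffAt X x) (hX' : VDiffAt X' x)
    (hY : VDiffAt Y x) (hZ : VDiffAt Z x) :
    koszul g (X + X') Y Z x = koszul g X Y Z x + koszul g X' Y Z x := by
  rw [koszul, mvfderiv_pairing_add_left hg hX hX' hZ, mvfderiv_pairing_add_left hg hX hX' hY,
    mlieBracket_add_left hX hX', mlieBracket_add_left hX hX']
  simp only [Pi.add_apply, map_add, add_apply, koszul]
  ring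

lemma koszul_add_middle (hg : PairsDifferentiably g) (hX : VDiffAt X x) (hY : VDiffAt Y x)
    (hY' : VDiffAt Y' x) (hZ : VDiffAt Z x) :
    koszul g X (Y + Y') Z x = koszul g X Y Z x + koszul g X Y' Z x := by
  rw [koszul, mvfderiv_pairing_add_left hg hY hY' hZ, mvfderiv_pairing_add_right hg hX hY hY',
    mlieBracket_add_left hY hY', mlieBracket_add_right hY hY']
  simp only [Pi.add_apply, map_add, add_apply, koszul]
  ring

lemma koszul_add_right (hg : PairsDifferentiably g) (hX : VDiffAt X x) (hY : VDiffAt Y x)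
    (hZ : VDiffAt Z x) (hZ' : VDiffAt Z' x) :
    koszul g X Y (Z + Z') x = koszul g X Y Z x + koszul g X Y Z' x := by
  rw [koszul, mvfderiv_pairing_add_right hg hY hZ hZ', mvfderiv_pairing_add_right hg hX hZ hZ',
    mlieBracket_add_right hZ hZ', mlieBracket_add_right hZ hZ']
  simp only [Pi.add_apply, map_add, add_apply, koszul]
  ring

lemma koszul_smul_left (hg : PairsDifferentiably g)
    {f : M → ℝ} (hf : MDifferentiableAt (𝓡 n) 𝓘(ℝ, ℝ) f x) (hX : VDiffAt X x) (hY : VDiffAt Y x)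
    (hZ : VDiffAt Z x) : koszul g (f • X) Y Z x = f x * koszul g X Y Z x := by
  rw [koszul, mvfderiv_pairing_smul_left hg hf hX hZ, mvfderiv_pairing_smul_left hg hf hX hY,
    mlieBracket_smul_left hf hX, mlieBracket_smul_left hf hX]
  simp only [Pi.smul_apply', map_smul, map_add, neg_smul, map_neg, neg_apply, add_apply, smul_apply,
    smul_eq_mul, koszul]
  ring

/-- The middle slot is the only one where derivatives of `f` survive: in the other two they cancel
between the differentiated pairings and the brackets. The surviving term is the Leibniz rule of the
connection. -/
lemma koszul_smul_middle (hsymm : ∀ x v w, g x v w = g x w v) (hg : PairsDifferentiably g)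
    {f : M → ℝ} (hf : MDifferentiableAt (𝓡 n) 𝓘(ℝ, ℝ) f x) (hX : VDiffAt X x) (hY : VDiffAt Y x)
    (hZ : VDiffAt Z x) :
    koszul g X (f • Y) Z x =
      f x * koszul g X Y Z x + 2 * (mvfderiv (𝓡 n) f x (X x) * g x (Y x) (Z x)) := by
  rw [koszul, mvfderiv_pairing_smul_left hg hf hY hZ, mvfderiv_pairing_smul_right hg hf hX hY,
    mlieBracket_smul_left hf hY, mlieBracket_smul_right hf hY]
  simp only [Pi.smul_apply', map_smul, map_add, neg_smul, map_neg, neg_apply, add_apply, smul_apply,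
    smul_eq_mul, koszul]
  rw [hsymm x (X x) (Y x)]
  ring

lemma koszul_smul_right (hsymm : ∀ x v w, g x v w = g x w v) (hg : PairsDifferentiably g)
    {f : M → ℝ} (hf : MDifferentiableAt (𝓡 n) 𝓘(ℝ, ℝ) f x) (hX : VDiffAt X x) (hY : VDiffAt Y x)
    (hZ : VDiffAt Z x) : koszul g X Y (f • Z) x = f x * koszul g X Y Z x := by
  rw [koszul, mvfderiv_pairing_smul_right hg hf hX hZ, mvfderiv_pairing_smul_right hg hf hY hZ,
    mlieBracket_smul_right hf hZ, mlieBracket_smul_right hf hZ]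
  simp only [Pi.smul_apply', map_smul, map_add, add_apply, smul_apply, smul_eq_mul, koszul]
  rw [hsymm x (Z x) (Y x), hsymm x (Z x) (X x)]
  ring

end Koszul

end Zermelo

/-! ### Construction of the Levi-Civita connection. -/

namespace Zermelo

section LeviCivita

open VectorField FiberBundle

variable {n : ℕ} {M : Type*} [TopologicalSpace M] [ChartedSpace (EuclideanSpace ℝ (Fin n)) M]
  {g : ∀ x : M, TangentSpace (𝓡 n) x →L[ℝ] TangentSpace (𝓡 n) x →L[ℝ] ℝ}

lemma eq_of_pairing_eq (hpos : ∀ x v, v ≠ 0 → 0 < g x v v) {x : M}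
    {v w : TangentSpace (𝓡 n) x} (hvw : ∀ u, g x v u = g x w u) : v = w := by
  by_contra hne
  have h1 := hpos x (v - w) (sub_ne_zero.2 hne)
  have h2 : g x (v - w) (v - w) = 0 := by rw [map_sub (g x), sub_apply, hvw, sub_self]
  exact h1.ne' h2

variable [IsManifold (𝓡 n) ∞ M]

lemma vdiffAt_extend {x : M} (v : TangentSpace (𝓡 n) x) :
    VDiffAt (extend (EuclideanSpace ℝ (Fin n)) v) x :=
  mdifferentiableAt_extend (𝓡 n) (EuclideanSpace ℝ (Fin n)) v

/-- The Koszul expression is represented by an endomorphism of the tangent space. -/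
lemma exists_endomorphism_koszul (hsymm : ∀ x v w, g x v w = g x w v)
    (hpos : ∀ x v, v ≠ 0 → 0 < g x v v) (hg : PairsDifferentiably g)
    (Y : ∀ x : M, TangentSpace (𝓡 n) x) (x : M) : ∃ A : TangentSpace (𝓡 n) x →L[ℝ]
      TangentSpace (𝓡 n) x, VDiffAt Y x → ∀ X Z, VDiffAt X x → VDiffAt Z x →
        2 * g x (A (X x)) (Z x) = koszul g X Y Z x := by
  by_cases hY : VDiffAt Y x
  swap
  -- A covariant derivative is a function on all fields, differentiable or not; `0` is the default
  -- value.
  · exact ⟨0, fun h ↦ absurd h hY⟩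
  have h₁ (Z : ∀ x : M, TangentSpace (𝓡 n) x) (hZ : VDiffAt Z x) :
      TensorialAt (𝓡 n) (EuclideanSpace ℝ (Fin n)) (fun X ↦ koszul g X Y Z x) x :=
    ⟨fun hf hX ↦ koszul_smul_left hg hf hX hY hZ, fun hX hX' ↦ koszul_add_left hg hX hX' hY hZ⟩
  have h₂ (X : ∀ x : M, TangentSpace (𝓡 n) x) (hX : VDiffAt X x) :
      TensorialAt (𝓡 n) (EuclideanSpace ℝ (Fin n)) (fun Z ↦ koszul g X Y Z x) x :=
    ⟨fun hf hZ ↦ koszul_smul_right hsymm hg hf hX hY hZ,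
      fun hZ hZ' ↦ koszul_add_right hg hX hY hZ hZ'⟩
  obtain ⟨G, hG⟩ : (g x).IsInvertible :=
    ContinuousLinearMap.isInvertible_of_pos (E := EuclideanSpace ℝ (Fin n)) (g x) (hpos x)
  refine ⟨(2⁻¹ : ℝ) • (G.symm : _ →L[ℝ] _) ∘L
    TensorialAt.mkHom₂ (fun X Z ↦ koszul g X Y Z x) x h₁ h₂, fun _ X Z hX hZ ↦ ?_⟩
  rw [← TensorialAt.mkHom₂_apply (Φ := fun X Z ↦ koszul g X Y Z x) h₁ h₂ hX hZ]
  simp [← hG]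

/-- Nondegeneracy reduces additivity and the Leibniz rule to the corresponding identities in the
middle slot of the Koszul expression, tested on local extensions of tangent vectors. -/
lemma exists_covariantDerivative_koszul (hsymm : ∀ x v w, g x v w = g x w v)
    (hpos : ∀ x v, v ≠ 0 → 0 < g x v v) (hg : PairsDifferentiably g) :
    ∃ cov : CovariantDerivative (𝓡 n) (EuclideanSpace ℝ (Fin n))
      (TangentSpace (𝓡 n) : M → Type _), ∀ X Y Z x, VDiffAt X x → VDiffAt Y x → VDiffAt Z x →
        2 * g x (cov Y x (X x)) (Z x) = koszul g X Y Z x := by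
  choose A hA using exists_endomorphism_koszul hsymm hpos hg
  refine ⟨⟨A, ⟨fun {Y Y' x} hY hY' _ ↦ ?_, fun {Y f x} hY hf _ ↦ ?_⟩⟩,
    fun X Y Z x hX hY hZ ↦ hA Y x hY X Z hX hZ⟩
  · ext1 v
    refine eq_of_pairing_eq hpos fun w ↦ ?_
    have hv := vdiffAt_extend v
    have hw := vdiffAt_extend w
    have h1 := hA _ x (mdifferentiableAt_add_section hY hY') _ _ hv hw
    have h2 := hA _ x hY _ _ hv hw
    have h3 := hA _ x hY' _ _ hv hw
    have h4 := koszul_add_middle hg hv hY hY' hw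
    simp only [extend_apply_self] at h1 h2 h3
    rw [add_apply, map_add, add_apply]
    linarith
  · ext1 v
    refine eq_of_pairing_eq hpos fun w ↦ ?_
    have hv := vdiffAt_extend v
    have hw := vdiffAt_extend w
    have h1 := hA _ x (hf.smul_section hY) _ _ hv hw
    have h2 := hA _ x hY _ _ hv hw
    have h4 := koszul_smul_middle hsymm hg hf hv hY hw
    simp only [extend_apply_self] at h1 h2 h4
    rw [add_apply, map_add, add_apply, smul_apply, map_smul, smul_apply,
      ContinuousLinearMap.smulRight_apply, map_smul, smul_apply, smul_eq_mul, smul_eq_mul]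
    rw [← h2] at h4
    linarith

end LeviCivita

end Zermelo

/-! ### Smoothness of the Levi-Civita connection. -/

section SmoothFamilies

variable {E : Type*} [NormedAddCommGroup E] [NormedSpace ℝ E]
  {H : Type*} [TopologicalSpace H] {I : ModelWithCorners ℝ E H}
  {M : Type*} [TopologicalSpace M] [ChartedSpace H M]
  {F : Type*} [NormedAddCommGroup F] [NormedSpace ℝ F]
  {G : Type*} [NormedAddCommGroup G] [NormedSpace ℝ G]
  {k : ℕ∞ω} {φ : M → F →L[ℝ] G} {x : M}

/-- A family of linear maps on a finite-dimensional space is `C^k` if it is pointwise `C^k`. -/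
lemma ContMDiffAt.clm_of_apply [FiniteDimensional ℝ F]
    (hφ : ∀ v, CMDiffAt k (fun y ↦ φ y v) x) : CMDiffAt k φ x := by
  let b := Module.finBasis ℝ F
  let ℓ (j) : F →L[ℝ] ℝ := (b.coord j).toContinuousLinearMap
  have h1 : φ = fun y ↦ ∑ j, ContinuousLinearMap.smulRightL ℝ F G (ℓ j) (φ y (b j)) := by
    ext y v
    conv_lhs => rw [← b.sum_repr v, map_sum]
    simp [ℓ]
  rw [h1]
  exact contMDiffAt_finsetSum fun j _ ↦
    (ContinuousLinearMap.contMDiff (ContinuousLinearMap.smulRightL ℝ F G (ℓ j))).contMDiffAt.comp x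
      (hφ (b j))

/-- A family of vectors is `C^k` if a `C^k` family of invertible linear maps sends it to a `C^k`
family. -/
lemma ContMDiffAt.of_clm_apply [CompleteSpace F] (hφ : CMDiffAt k φ x)
    (hinv : (φ x).IsInvertible) {z : M → F} (hz : CMDiffAt k (fun y ↦ φ y (z y)) x) :
    CMDiffAt k z x := by
  have h1 : CMDiffAt k (fun y ↦ (φ y).inverse (φ y (z y))) x :=
    (hinv.contDiffAt_map_inverse.contMDiffAt.comp x hφ).clm_apply hz
  refine h1.congr_of_eventuallyEq ?_
  obtain ⟨A₀, hA₀⟩ := hinv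
  -- Invertible maps form an open set, so `(φ y).inverse` undoes `φ y` for `y` near `x`.
  filter_upwards [hφ.continuousAt.preimage_mem_nhds (hA₀ ▸ ContinuousLinearEquiv.nhds A₀)]
    with y ⟨A, hA⟩
  simp [← hA]

end SmoothFamilies

namespace Zermelo

section SmoothLeviCivita

open VectorField FiberBundle

variable {n : ℕ} {M : Type*} [TopologicalSpace M] [ChartedSpace (EuclideanSpace ℝ (Fin n)) M]
  [IsManifold (𝓡 n) ∞ M]
  {g : ∀ x : M, TangentSpace (𝓡 n) x →L[ℝ] TangentSpace (𝓡 n) x →L[ℝ] ℝ}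
  {X Y Z : ∀ x : M, TangentSpace (𝓡 n) x} {x : M}

/-- The bilinear form `g` pairs smooth vector fields to smooth functions. -/
abbrev PairsSmoothly
    (g : ∀ x : M, TangentSpace (𝓡 n) x →L[ℝ] TangentSpace (𝓡 n) x →L[ℝ] ℝ) : Prop :=
  ∀ Y Z x, VSmoothAt Y x → VSmoothAt Z x →
    ContMDiffAt (𝓡 n) 𝓘(ℝ, ℝ) ∞ (fun y ↦ g y (Y y) (Z y)) x

/-- A field of endomorphisms of the tangent spaces is smooth if it sends smooth vector fields to
smooth vector fields. -/
lemma contMDiffAt_endomorphism_of_apply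
    {φ : ∀ x : M, TangentSpace (𝓡 n) x →L[ℝ] TangentSpace (𝓡 n) x}
    (hφ : ∀ X, (∀ᶠ y in 𝓝 x, VSmoothAt X y) → VSmoothAt (fun y ↦ φ y (X y)) x) :
    ContMDiffAt (𝓡 n) ((𝓡 n).prod
      𝓘(ℝ, EuclideanSpace ℝ (Fin n) →L[ℝ] EuclideanSpace ℝ (Fin n))) ∞
      (fun y ↦ TotalSpace.mk' (EuclideanSpace ℝ (Fin n) →L[ℝ] EuclideanSpace ℝ (Fin n))
        (E := fun x : M ↦ TangentSpace (𝓡 n) x →L[ℝ] TangentSpace (𝓡 n) x) y (φ y)) x := by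
  rw [contMDiffAt_hom_bundle]
  refine ⟨contMDiffAt_id, ContMDiffAt.clm_of_apply fun v ↦ ?_⟩
  let e := trivializationAt (EuclideanSpace ℝ (Fin n)) (TangentSpace (𝓡 n) : M → Type _) x
  have hx : x ∈ e.baseSet := mem_baseSet_trivializationAt' x
  have h1 := hφ (fun y ↦ e.symmL ℝ y v) (by
    filter_upwards [e.open_baseSet.mem_nhds hx] with y hy
    exact e.contMDiffAt_symmL_apply hy v)
  refine ((e.contMDiffAt_section_iff hx).1 h1).congr_of_eventuallyEq ?_
  filter_upwards [e.open_baseSet.mem_nhds hx] with y hy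
  exact e.continuousLinearMapAt_apply_of_mem (R := ℝ) hy _

/-- The derivative of a smooth function along a smooth vector field is smooth. -/
lemma contMDiffAt_mvfderiv_apply {f : M → ℝ} (hf : ContMDiffAt (𝓡 n) 𝓘(ℝ, ℝ) ∞ f x)
    (hX : VSmoothAt X x) :
    ContMDiffAt (𝓡 n) 𝓘(ℝ, ℝ) ∞ (fun y ↦ mvfderiv (𝓡 n) f y (X y)) x := by
  let e := trivializationAt (EuclideanSpace ℝ (Fin n)) (TangentSpace (𝓡 n) : M → Type _) x
  have hx : x ∈ e.baseSet := mem_baseSet_trivializationAt' x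
  have h1 := (hf.mfderiv_const (m := ∞) (by simp)).clm_apply
    ((e.contMDiffAt_section_iff hx).1 hX)
  refine h1.congr_of_eventuallyEq ?_
  filter_upwards [e.open_baseSet.mem_nhds hx] with y hy
  have h2 : e.symmL ℝ y (e ⟨y, X y⟩).2 = X y := by
    rw [e.symmL_apply hy]
    exact e.symm_apply_apply_mk hy _
  conv_lhs => rw [← h2]
  have h3 : (trivializationAt ℝ (TangentSpace 𝓘(ℝ, ℝ)) (f x)).continuousLinearMapAt ℝ (f y) =
      (1 : ℝ →L[ℝ] ℝ) := TangentBundle.continuousLinearMapAt_model_space (𝕜 := ℝ) (F := ℝ) _ _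
  exact (congrArg (fun A : ℝ →L[ℝ] ℝ ↦ A (mfderiv (𝓡 n) 𝓘(ℝ, ℝ) f y (e.symmL ℝ y
    (e ⟨y, X y⟩).2))) h3).symm

lemma contMDiffAt_koszul (hg : PairsSmoothly g) (hX : ∀ᶠ y in 𝓝 x, VSmoothAt X y)
    (hY : ∀ᶠ y in 𝓝 x, VSmoothAt Y y) (hZ : ∀ᶠ y in 𝓝 x, VSmoothAt Z y) :
    ContMDiffAt (𝓡 n) 𝓘(ℝ, ℝ) ∞ (koszul g X Y Z) x := by
  have hb {U V : ∀ x : M, TangentSpace (𝓡 n) x} (hU : VSmoothAt U x) (hV : VSmoothAt V x) :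
      VSmoothAt (mlieBracket (𝓡 n) U V) x :=
    haveI : IsManifold (𝓡 n) (minSmoothness ℝ 2) M :=
      by rw [minSmoothness_of_isRCLikeNormedField]; infer_instance
    haveI : IsManifold (𝓡 n) (((⊤ : ℕ∞) : ℕ∞ω) + 1) M := .of_le (n := ∞) (by simp)
    ContMDiffAt.mlieBracket_vectorField (m := ⊤) (n := ⊤) hU hV (by simp)
  have hX := hX.self_of_nhds
  have hY := hY.self_of_nhds
  have hZ := hZ.self_of_nhds
  exact (((((contMDiffAt_mvfderiv_apply (hg _ _ _ hY hZ) hX).add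
    (contMDiffAt_mvfderiv_apply (hg _ _ _ hX hZ) hY)).sub
    (contMDiffAt_mvfderiv_apply (hg _ _ _ hX hY) hZ)).add (hg _ _ _ (hb hX hY) hZ)).sub
    (hg _ _ _ (hb hX hZ) hY)).sub (hg _ _ _ (hb hY hZ) hX)

/-- A vector field is smooth if its products with smooth vector fields are smooth. -/
lemma vsmoothAt_of_pairing (hpos : ∀ x v, v ≠ 0 → 0 < g x v v) (hg : PairsSmoothly g)
    (hY : ∀ Z, (∀ᶠ y in 𝓝 x, VSmoothAt Z y) →
      ContMDiffAt (𝓡 n) 𝓘(ℝ, ℝ) ∞ (fun y ↦ g y (Y y) (Z y)) x) : VSmoothAt Y x := by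
  let e := trivializationAt (EuclideanSpace ℝ (Fin n)) (TangentSpace (𝓡 n) : M → Type _) x
  have hx : x ∈ e.baseSet := mem_baseSet_trivializationAt' x
  have hE (v) : ∀ᶠ y in 𝓝 x, VSmoothAt (fun y ↦ e.symmL ℝ y v) y := by
    filter_upwards [e.open_baseSet.mem_nhds hx] with y hy
    exact e.contMDiffAt_symmL_apply hy v
  -- The Gram form of `g` in the trivialization. It is smooth and positive definite at `x`, so the
  -- coordinates of `Y` depend smoothly on its pairings with the frame.
  let G (y : M) : EuclideanSpace ℝ (Fin n) →L[ℝ] EuclideanSpace ℝ (Fin n) →L[ℝ] ℝ :=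
    letI S : EuclideanSpace ℝ (Fin n) →L[ℝ] EuclideanSpace ℝ (Fin n) := e.symmL ℝ y
    letI gy : EuclideanSpace ℝ (Fin n) →L[ℝ] EuclideanSpace ℝ (Fin n) →L[ℝ] ℝ := g y
    gy.bilinearComp S S
  have hG : ContMDiffAt (𝓡 n)
      𝓘(ℝ, EuclideanSpace ℝ (Fin n) →L[ℝ] EuclideanSpace ℝ (Fin n) →L[ℝ] ℝ) ∞ G x :=
    ContMDiffAt.clm_of_apply fun v ↦ ContMDiffAt.clm_of_apply fun w ↦
      hg _ _ _ (hE v).self_of_nhds (hE w).self_of_nhds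
  refine (e.contMDiffAt_section_iff hx).2 (hG.of_clm_apply ?_ ?_)
  · refine ContinuousLinearMap.isInvertible_of_pos _ fun v hv ↦ hpos x _ fun h0 ↦ hv ?_
    exact (e.continuousLinearMapAt_symmL (R := ℝ) hx v).symm.trans
      ((congrArg (e.continuousLinearMapAt ℝ x) h0).trans (map_zero _))
  · refine ContMDiffAt.clm_of_apply fun w ↦ (hY _ (hE w)).congr_of_eventuallyEq ?_
    filter_upwards [e.open_baseSet.mem_nhds hx] with y hy
    have h2 : e.symmL ℝ y (e ⟨y, Y y⟩).2 = Y y := by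
      rw [e.symmL_apply hy]
      exact e.symm_apply_apply_mk hy _
    conv_rhs => rw [← h2]
    rfl

/-- Existence of the Levi-Civita connection. -/
theorem exists_isLeviCivita (hsymm : ∀ x v w, g x v w = g x w v)
    (hpos : ∀ x v, v ≠ 0 → 0 < g x v v) (hdiff : PairsDifferentiably g) (hg : PairsSmoothly g) :
    ∃ cov, IsLeviCivita g cov := by
  obtain ⟨cov, hcov⟩ := exists_covariantDerivative_koszul hsymm hpos hdiff
  refine ⟨cov, ⟨⟨fun {Y} hY ↦ ?_⟩⟩, ?_, fun Y Z x hY hZ v ↦ ?_⟩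
  · have hY' (y : M) : VSmoothAt Y y := by
      have := hY.contMDiffAt (x := y) Filter.univ_mem
      simpa using this
    refine fun x _ ↦ (contMDiffAt_endomorphism_of_apply fun X hX ↦
      vsmoothAt_of_pairing hpos hg fun Z hZ ↦ ?_).contMDiffWithinAt
    have h1 : ContMDiffAt (𝓡 n) 𝓘(ℝ, ℝ) ∞ (fun y ↦ 2⁻¹ * koszul g X Y Z y) x :=
      contMDiffAt_const.mul (contMDiffAt_koszul hg hX (Filter.Eventually.of_forall hY') hZ)
    refine h1.congr_of_eventuallyEq ?_
    filter_upwards [hX, hZ] with y hXy hZy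
    rw [← hcov X Y Z y hXy.vdiffAt (hY' y).vdiffAt hZy.vdiffAt]
    ring
  · rw [CovariantDerivative.torsion_eq_zero_iff]
    intro X Y x hX hY
    refine eq_of_pairing_eq hpos fun w ↦ ?_
    have hw := vdiffAt_extend w
    have h1 := hcov X Y _ x hX hY hw
    have h2 := hcov Y X _ x hY hX hw
    have h3 := koszul_sub_swap (X := X) (Y := Y) (Z := extend (EuclideanSpace ℝ (Fin n)) w) (x := x)
      hsymm
    rw [← h1, ← h2] at h3
    simp only [extend_apply_self] at h3
    rw [map_sub, sub_apply]
    linarith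
  · have hv := vdiffAt_extend v
    have h1 := hcov _ Y Z x hv hY hZ
    have h2 := hcov _ Z Y x hv hZ hY
    have h3 := koszul_add_swap (X := extend (EuclideanSpace ℝ (Fin n)) v) (Y := Y) (Z := Z) (x := x)
      hsymm
    rw [← h1, ← h2] at h3
    simp only [extend_apply_self] at h3
    rw [hsymm x (Y x)]
    linarith

end SmoothLeviCivita

end Zermelo

/-! ### The metric connection that makes a field of constant length parallel. -/

/-- For a bilinear form `g`, an endomorphism `D` and a vector `b`, the bilinear map
`(y, v) ↦ (g(D v, y) b - g(y, b) D v) / g(b, b)`. -/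
noncomputable def ContinuousLinearMap.wedge {E : Type*} [NormedAddCommGroup E] [NormedSpace ℝ E]
    (g : E →L[ℝ] E →L[ℝ] ℝ) (D : E →L[ℝ] E) (b : E) : E →L[ℝ] E →L[ℝ] E :=
  (g b b)⁻¹ • ((ContinuousLinearMap.smulRightL ℝ E E).flip b ∘L (g ∘L D).flip -
    (g.flip b).smulRight D)

namespace Zermelo

section ParallelConnection

variable {n : ℕ} {M : Type*} [TopologicalSpace M] [ChartedSpace (EuclideanSpace ℝ (Fin n)) M]
  [IsManifold (𝓡 n) ∞ M]
  {g : ∀ x : M, TangentSpace (𝓡 n) x →L[ℝ] TangentSpace (𝓡 n) x →L[ℝ] ℝ}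
  {covA : CovariantDerivative (𝓡 n) (EuclideanSpace ℝ (Fin n)) (TangentSpace (𝓡 n) : M → Type _)}
  {B : ∀ x : M, TangentSpace (𝓡 n) x}

/-- The one-form with values in the endomorphisms of the tangent spaces which has to be added to a
metric connection in order to make the vector field `B` of constant length parallel. -/
noncomputable def parallelOneForm
    (g : ∀ x : M, TangentSpace (𝓡 n) x →L[ℝ] TangentSpace (𝓡 n) x →L[ℝ] ℝ)
    (covA : CovariantDerivative (𝓡 n) (EuclideanSpace ℝ (Fin n))
      (TangentSpace (𝓡 n) : M → Type _))
    (B : ∀ x : M, TangentSpace (𝓡 n) x) (x : M) :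
    TangentSpace (𝓡 n) x →L[ℝ] TangentSpace (𝓡 n) x →L[ℝ] TangentSpace (𝓡 n) x :=
  ContinuousLinearMap.wedge (E := EuclideanSpace ℝ (Fin n)) (g x) (covA B x) (B x)

/-- The connection `covA + parallelOneForm g covA B`. -/
noncomputable def parallelConnection
    (g : ∀ x : M, TangentSpace (𝓡 n) x →L[ℝ] TangentSpace (𝓡 n) x →L[ℝ] ℝ)
    (covA : CovariantDerivative (𝓡 n) (EuclideanSpace ℝ (Fin n))
      (TangentSpace (𝓡 n) : M → Type _))
    (B : ∀ x : M, TangentSpace (𝓡 n) x) :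
    CovariantDerivative (𝓡 n) (EuclideanSpace ℝ (Fin n)) (TangentSpace (𝓡 n) : M → Type _) :=
  ⟨fun Y x ↦ covA Y x + parallelOneForm g covA B x (Y x),
    covA.isCovariantDerivativeOnUniv.add_one_form _⟩

lemma parallelConnection_apply (Y : ∀ x : M, TangentSpace (𝓡 n) x) (x : M)
    (v : TangentSpace (𝓡 n) x) :
    parallelConnection g covA B Y x v = covA Y x v +
      (g x (B x) (B x))⁻¹ • (g x (covA B x v) (Y x) • B x - g x (Y x) (B x) • covA B x v) := rfl

/-- For each direction the added endomorphism is skew with respect to `g`, so its contributions to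
the product rule cancel, whatever the length of `B`. -/
lemma isMetricFor_parallelConnection (hsymm : ∀ x v w, g x v w = g x w v)
    (hcovA : IsMetricFor g covA) : IsMetricFor g (parallelConnection g covA B) := by
  intro Y Z x hY hZ v
  rw [hcovA Y Z x hY hZ v, parallelConnection_apply, parallelConnection_apply]
  simp only [map_add, map_sub, map_smul, add_apply, sub_apply, smul_apply, smul_eq_mul]
  rw [hsymm x (Y x) (covA B x v), hsymm x (B x) (Z x)]
  ring

/-- Differentiating `g(B, B) = r` shows that the derivative of `B` is orthogonal to `B`; the added
term at `B` is then minus that derivative. If `r = 0`, positivity forces `B = 0`. -/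
lemma parallelConnection_self (hsymm : ∀ x v w, g x v w = g x w v)
    (hpos : ∀ x v, v ≠ 0 → 0 < g x v v) (hcovA : IsMetricFor g covA) (hB : ∀ x, VDiffAt B x)
    {r : ℝ} (hr : ∀ x, g x (B x) (B x) = r) (x : M) : parallelConnection g covA B B x = 0 := by
  ext1 v
  have h1 := hcovA B B x (hB x) (hB x) v
  have h2 : (fun y ↦ g y (B y) (B y)) = fun _ ↦ r := funext hr
  rw [h2, mvfderiv_const, hsymm x (B x)] at h1
  have h3 : g x (covA B x v) (B x) = 0 := by
    have : (0 : ℝ) = g x (covA B x v) (B x) + g x (covA B x v) (B x) := h1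
    linarith
  rw [parallelConnection_apply, h3, hr, zero_smul, zero_sub]
  rcases eq_or_ne r 0 with h0 | h0
  · have hB0 : B = 0 := by
      ext1 y
      by_contra hne
      exact (hpos y (B y) hne).ne' ((hr y).trans h0)
    have h4 : covA B x = 0 := by rw [hB0, CovariantDerivative.zero]; rfl
    simp [h4]
  · rw [smul_neg, smul_smul, inv_mul_cancel₀ h0, one_smul, add_neg_cancel]
    rfl

/-- Constant length turns the denominator into the constant `r`, so no division by a function occurs
and `r = 0` needs no separate treatment, as `0⁻¹ = 0`. -/
lemma contMDiff_parallelConnection (hg : PairsSmoothly g)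
    (hcovA : CovariantDerivative.ContMDiffCovariantDerivative covA ∞) (hB : ∀ x, VSmoothAt B x)
    {r : ℝ} (hr : ∀ x, g x (B x) (B x) = r) :
    CovariantDerivative.ContMDiffCovariantDerivative (parallelConnection g covA B) ∞ := by
  have hcov {X Y : ∀ x : M, TangentSpace (𝓡 n) x} {x : M} (hX : VSmoothAt X x)
      (hY : ∀ x, VSmoothAt Y x) : VSmoothAt (fun y ↦ covA Y y (X y)) x := by
    have hY' : ContMDiffOn (𝓡 n) (𝓡 n).tangent (∞ + 1) (fun y ↦
        (TotalSpace.mk' (EuclideanSpace ℝ (Fin n)) y (Y y) : TangentBundle (𝓡 n) M)) univ :=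
      fun y _ ↦ by simpa using (hY y).contMDiffWithinAt
    exact ContMDiffAt.clm_bundle_apply (F₁ := EuclideanSpace ℝ (Fin n))
      (F₂ := EuclideanSpace ℝ (Fin n))
      ((hcovA.contMDiff.contMDiff hY').contMDiffAt Filter.univ_mem) hX
  refine ⟨⟨fun {Y} hY ↦ ?_⟩⟩
  have hY' (y : M) : VSmoothAt Y y := by
    have := hY.contMDiffAt (x := y) Filter.univ_mem
    simpa using this
  refine fun x _ ↦ (contMDiffAt_endomorphism_of_apply fun X hX ↦ ?_).contMDiffWithinAt
  have hX := hX.self_of_nhds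
  have h1 : (fun y ↦ parallelConnection g covA B Y y (X y)) = fun y ↦ covA Y y (X y) +
      r⁻¹ • (g y (covA B y (X y)) (Y y) • B y - g y (Y y) (B y) • covA B y (X y)) := by
    ext1 y
    rw [parallelConnection_apply, hr]
  rw [h1]
  refine (hcov hX hY').add_section (ContMDiffAt.const_smul_section (((hg _ _ _ (hcov hX hB)
    (hY' x)).smul_section (hB x)).sub_section ((hg _ _ _ (hY' x) (hB x)).smul_section
    (hcov hX hB))))

end ParallelConnection

section Navigation

variable {n : ℕ} {M : Type*} [TopologicalSpace M] [ChartedSpace (EuclideanSpace ℝ (Fin n)) M]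
  [IsManifold (𝓡 n) ∞ M]
  {h : ContMDiffRiemannianMetric (𝓡 n) ∞ (EuclideanSpace ℝ (Fin n))
    (TangentSpace (𝓡 n) : M → Type _)}
  {W : ∀ x : M, TangentSpace (𝓡 n) x}

/-- A metric connection for `alpha` with respect to which `betaSharp` is parallel preserves the
Randers metric. -/
lemma preservesByTransport_randersNorm (hW : ∀ x, VSmoothAt W x)
    (hlt : ∀ x : M, h.inner x (W x) (W x) < 1)
    {cov : CovariantDerivative (𝓡 n) (EuclideanSpace ℝ (Fin n))
      (TangentSpace (𝓡 n) : M → Type _)} (hcov : IsMetricFor (alpha h W) cov)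
    (h0 : ∀ x, cov (betaSharp h W) x = 0) : PreservesByTransport cov (randersNorm h W) := by
  intro a b hab c hc V hV
  have hg (Y Z : ∀ x : M, TangentSpace (𝓡 n) x) (x : M) (hY : VDiffAt Y x) (hZ : VDiffAt Z x) :
      MDifferentiableAt (𝓡 n) 𝓘(ℝ, ℝ) (fun y ↦ alpha h W y (Y y) (Z y)) x :=
    mdifferentiableAt_alpha (lam_pos hlt x) (hW x) hY hZ
  have hB : IsParallelAlong cov c (fun t ↦ betaSharp h W (c t)) (Icc a b) :=
    isParallelAlong_comp_curve (fun x ↦ (vsmoothAt_betaSharp hlt (hW x)).vdiffAt) h0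
      (uniqueDiffOn_Icc hab) (hc.mdifferentiableOn (by simp))
  have h1 := hcov.eq_of_isParallelAlong hg hab hV hV
  have h2 := hcov.eq_of_isParallelAlong hg hab hB hV
  -- Since `α(β♯, ·) = β`, the constancy of `α(β♯, V)` is that of `β(V)`.
  rw [alpha_betaSharp (lam_pos hlt _), alpha_betaSharp (lam_pos hlt _)] at h2
  rw [randersNorm_eq (lam_pos hlt _), randersNorm_eq (lam_pos hlt _), h1, h2]

end Navigation

end Zermelo

/-! ### Proof of the theorem. -/

theorem mainTheorem5 {n : ℕ} {M : Type*} [TopologicalSpace M] [T2Space M] [ConnectedSpace M]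
    [ChartedSpace (EuclideanSpace ℝ (Fin n)) M] [IsManifold (𝓡 n) ∞ M]
    (h : ContMDiffRiemannianMetric (𝓡 n) ∞ (EuclideanSpace ℝ (Fin n))
      (TangentSpace (𝓡 n) : M → Type _))
    (W : ∀ x : M, TangentSpace (𝓡 n) x)
    (hW : ContMDiff (𝓡 n) (𝓡 n).tangent ∞
      (fun x ↦ (TotalSpace.mk' (EuclideanSpace ℝ (Fin n)) x (W x) : TangentBundle (𝓡 n) M)))
    (hlt : ∀ x : M, h.inner x (W x) (W x) < 1) :
    (Zermelo.HasConstantLength h.inner W ↔ Zermelo.IsWagnerian (Zermelo.randersNorm h W)) ∧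
    (Zermelo.HasConstantLength (Zermelo.alpha h W) (Zermelo.betaSharp h W) ↔
      Zermelo.IsWagnerian (Zermelo.randersNorm h W)) ∧
    (∃ covA : CovariantDerivative (𝓡 n) (EuclideanSpace ℝ (Fin n))
      (TangentSpace (𝓡 n) : M → Type _), Zermelo.IsLeviCivita (Zermelo.alpha h W) covA) ∧
    (Zermelo.HasConstantLength h.inner W →
      ∀ covA : CovariantDerivative (𝓡 n) (EuclideanSpace ℝ (Fin n))
        (TangentSpace (𝓡 n) : M → Type _), Zermelo.IsLeviCivita (Zermelo.alpha h W) covA →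
      ∃ cov : CovariantDerivative (𝓡 n) (EuclideanSpace ℝ (Fin n))
        (TangentSpace (𝓡 n) : M → Type _),
        (∀ (Y : ∀ x : M, TangentSpace (𝓡 n) x) (x : M) (v : TangentSpace (𝓡 n) x),
          cov Y x v = covA Y x v +
            (Zermelo.alpha h W x (Zermelo.betaSharp h W x) (Zermelo.betaSharp h W x))⁻¹ •
              (Zermelo.alpha h W x (covA (Zermelo.betaSharp h W) x v) (Y x) •
                  Zermelo.betaSharp h W x -
                Zermelo.alpha h W x (Y x) (Zermelo.betaSharp h W x) •
                  covA (Zermelo.betaSharp h W) x v)) ∧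
        CovariantDerivative.ContMDiffCovariantDerivative cov ∞ ∧
        Zermelo.IsMetricFor (Zermelo.alpha h W) cov ∧
        (∀ x : M, cov (Zermelo.betaSharp h W) x = 0) ∧
        Zermelo.PreservesByTransport cov (Zermelo.randersNorm h W)) := by
  have hWx (x : M) : Zermelo.VSmoothAt W x := hW x
  have hlam := Zermelo.lam_pos (h := h) (W := W) hlt
  have hsymm := Zermelo.alpha_symm (h := h) (W := W)
  have hpos (x : M) := Zermelo.alpha_pos (hlam x)
  have hsmooth : Zermelo.PairsSmoothly (Zermelo.alpha h W) := fun Y Z x hY hZ ↦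
    Zermelo.contMDiffAt_alpha (hlam x) (hWx x) hY hZ
  have hdiff : Zermelo.PairsDifferentiably (Zermelo.alpha h W) := fun Y Z x hY hZ ↦
    Zermelo.mdifferentiableAt_alpha (hlam x) (hWx x) hY hZ
  have hB (x : M) := Zermelo.vsmoothAt_betaSharp hlt (hWx x)
  have hexists := Zermelo.exists_isLeviCivita hsymm hpos hdiff hsmooth
  have key (hconst : Zermelo.HasConstantLength h.inner W)
      (covA : CovariantDerivative (𝓡 n) (EuclideanSpace ℝ (Fin n))
        (TangentSpace (𝓡 n) : M → Type _))
      (hcovA : Zermelo.IsLeviCivita (Zermelo.alpha h W) covA) :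
      let cov := Zermelo.parallelConnection (Zermelo.alpha h W) covA (Zermelo.betaSharp h W)
      CovariantDerivative.ContMDiffCovariantDerivative cov ∞ ∧
        Zermelo.IsMetricFor (Zermelo.alpha h W) cov ∧
        (∀ x : M, cov (Zermelo.betaSharp h W) x = 0) ∧
        Zermelo.PreservesByTransport cov (Zermelo.randersNorm h W) := by
    obtain ⟨r, hr⟩ := (Zermelo.hasConstantLength_betaSharp_iff hlt).2 hconst
    -- The length `r` is a square root, hence the constant value of `α(β♯, β♯)` is `r ^ 2`.
    have hr' (x : M) : Zermelo.alpha h W x (Zermelo.betaSharp h W x) (Zermelo.betaSharp h W x) =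
        r ^ 2 := by
      rw [← hr x, Real.sq_sqrt (Zermelo.alpha_self_nonneg (hlam x) _)]
    have hmetric := Zermelo.isMetricFor_parallelConnection (B := Zermelo.betaSharp h W) hsymm
      hcovA.2.2
    have hzero := Zermelo.parallelConnection_self hsymm hpos hcovA.2.2
      (fun x ↦ (hB x).vdiffAt) hr'
    exact ⟨Zermelo.contMDiff_parallelConnection hsmooth hcovA.1 hB hr', hmetric, hzero,
      Zermelo.preservesByTransport_randersNorm hWx hlt hmetric hzero⟩
  have hiff : Zermelo.HasConstantLength h.inner W ↔
      Zermelo.IsWagnerian (Zermelo.randersNorm h W) := by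
    refine ⟨fun hconst ↦ ?_, fun hF ↦ hF.hasConstantLength hlt⟩
    obtain ⟨covA, hcovA⟩ := hexists
    obtain ⟨h1, -, -, h2⟩ := key hconst covA hcovA
    exact ⟨_, h1, h2⟩
  exact ⟨hiff, (Zermelo.hasConstantLength_betaSharp_iff hlt).trans hiff, hexists,
    fun hconst covA hcovA ↦ ⟨_, Zermelo.parallelConnection_apply, key hconst covA hcovA⟩⟩
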